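/- Let $N\in\mathbb N$ and $1<p<N$. Let $V:(0,\infty)\to[0,\infty]$ be measurable with $V\in L^1((r_1,r_2))$ for some $r_2>r_1>0$, and let $K:(0,\infty)\to(0,\infty)$ be measurable with $K\in L^s_{\mathrm{loc}}((0,\infty))$ for some $s>1$ such that $s>\frac{Np}{N(p-1)+p}$. With $p^*=\frac{pN}{N-p}$ and $D^{1,p}(\mathbb R^N)=\{u\in L^{p^*}(\mathbb R^N):\nabla u\in L^p(\mathbb R^N)\}$, set $$W=\Big\{u\in D^{1,p}(\mathbb R^N):\int_{\mathbb R^N}V(|x|)|u|^p\,dx<\infty\Big\},\qquad \|u\|^p=\int_{\mathbb R^N}\big(|\nabla u|^p+V(|x|)|u|^p\big)\,dx,$$ and let $W_r$ be the subspace of the radial functions in $W$. Let $g:(0,\infty)\times\mathbb R\to\mathbb R$ be a Carathéodory function such that the linear operator $h\mapsto\int_{\mathbb R^N}g(|x|,0)h\,dx$ is well defined and continuous on the whole space $W$, and such that for some continuous $f:\mathbb R\to\mathbb R$ $$|g(r,t)-g(r,0)|\le K(r)|f(t)|\qquad\text{for a.e. } r>0\text{ and all }t\in\mathbb R.$$ Assume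 that there are $q_1,q_2>1$ such that * for some $M>0$, $|f(t)|\le M\min\{|t|^{q_1-1},|t|^{q_2-1}\}$ for all $t\in\mathbb R$; * for some $R_1,R_2>0$, $$\sup_{\substack{u\in W_r,\ h\in W\\ \|u\|=\|h\|=1}}\int_{|x|<R_1}K(|x|)|u|^{q_1-1}|h|\,dx<\infty,\qquad \sup_{\substack{u\in W_r,\ h\in W\\ \|u\|=\|h\|=1}}\int_{|x|\ge R_2}K(|x|)|u|^{q_2-1}|h|\,dx<\infty.$$ Put $G(r,t)=\int_0^t g(r,\tau)\,d\tau$ and $I(u)=\frac1p\|u\|^p-\int_{\mathbb R^N}G(|x|,u)\,dx$ for $u\in W_r$. Then every critical point $u$ of $I:W_r\to\mathbb R$ (that is, every $u\in W_r$ at which $I$ is Fréchet differentiable on $W_r$ with $I'(u)=0$) is a weak solution of $-\Delta_pu+V(|x|)|u|^{p-2}u=g(|x|,u)$ in $\mathbb R^N$, in the sense that for every $h\in W$ (radial or not) the integrals below exist and $$\int_{\mathbb R^N}|\nabla u|^{p-2}\nabla u\cdot\nabla h\,dx+\int_{\mathbb R^N}V(|x|)|u|^{p-2}uh\,dx=\int_{\mathbb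 R^N}g(|x|,u)h\,dx.$$ -/

import Mathlib

open MeasureTheory Set
open scoped ENNReal ContDiff

noncomputable section

namespace PLap

/-- The Euclidean space `ℝ^N`. -/
abbrev E (N : ℕ) : Type := EuclideanSpace ℝ (Fin N)

/-- `V : (0,∞) → [0,∞]` is (Lebesgue) measurable and integrable over some interval `(r₁,r₂)` with
`0 < r₁ < r₂`. Only the values of `V` on `(0,∞)` matter. -/
def CondV (V : ℝ → ℝ≥0∞) : Prop :=
  AEMeasurable V (volume.restrict (Ioi (0 : ℝ))) ∧
    ∃ r₁ r₂ : ℝ, 0 < r₁ ∧ r₁ < r₂ ∧ ∫⁻ r in Ioo r₁ r₂, V r < ⊤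

/-- `K : (0,∞) → (0,∞)` is (Lebesgue) measurable and belongs to `L^s_loc((0,∞))`. -/
def CondK (s : ℝ) (K : ℝ → ℝ) : Prop :=
  AEMeasurable K (volume.restrict (Ioi (0 : ℝ))) ∧ (∀ r : ℝ, 0 < r → 0 < K r) ∧
    ∀ a b : ℝ, 0 < a → a < b → MemLp K (ENNReal.ofReal s) (volume.restrict (Icc a b))

/-- `G` is the weak (distributional) gradient of `u` on `ℝ^N`: both are locally integrable and
`∫ u ∂_v φ = - ∫ ⟨G, v⟩ φ` for all `φ ∈ C_c^∞(ℝ^N)` and all directions `v`. -/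
def HasWeakGradient {N : ℕ} (u : E N → ℝ) (G : E N → E N) : Prop :=
  LocallyIntegrable u ∧ LocallyIntegrable G ∧
    ∀ φ : E N → ℝ, ContDiff ℝ ∞ φ → HasCompactSupport φ → ∀ v : E N,
      ∫ x, u x * fderiv ℝ φ x v = - ∫ x, inner ℝ (G x) v * φ x

open Classical in
/-- The weak gradient of `u` (unique up to null sets), and `0` if there is none. -/
def weakGradient {N : ℕ} (u : E N → ℝ) : E N → E N :=
  if h : ∃ G : E N → E N, HasWeakGradient u G then h.choose else 0

/-- The Sobolev critical exponent `p* = pN/(N-p)`. -/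
def sobolevExponent (N : ℕ) (p : ℝ) : ℝ := p * N / (N - p)

/-- `u ∈ D^{1,p}(ℝ^N)`, i.e. `u ∈ L^{p*}` has a weak gradient and that gradient is in `L^p`.
Functions are used as representatives of their a.e. classes. -/
def MemD {N : ℕ} (p : ℝ) (u : E N → ℝ) : Prop :=
  MemLp u (ENNReal.ofReal (sobolevExponent N p)) volume ∧
    (∃ G : E N → E N, HasWeakGradient u G) ∧
    MemLp (weakGradient u) (ENNReal.ofReal p) volume

/-- `u ∈ W = D^{1,p}(ℝ^N) ∩ L^p(ℝ^N, V(|x|) dx)`. Where `V = ∞`, the convention `∞ * 0 = 0` of the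
Lebesgue integral applies, so that finiteness forces `u = 0` a.e. on `{V(|x|) = ∞}`. -/
def MemW {N : ℕ} (p : ℝ) (V : ℝ → ℝ≥0∞) (u : E N → ℝ) : Prop :=
  MemD p u ∧ ∫⁻ x, V ‖x‖ * ‖u x‖ₑ ^ p < ⊤

/-- `u` is (a.e. equal to) a function of `|x|`. -/
def IsRadial {N : ℕ} (u : E N → ℝ) : Prop :=
  ∃ φ : ℝ → ℝ, ∀ᵐ x : E N, u x = φ ‖x‖

/-- `u ∈ W_r`, the subspace of radial elements of `W`. -/
def MemWr {N : ℕ} (p : ℝ) (V : ℝ → ℝ≥0∞) (u : E N → ℝ) : Prop :=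
  MemW p V u ∧ IsRadial u

/-- The norm of `W`: `‖u‖^p = ∫ (|∇u|^p + V(|x|)|u|^p) dx`. -/
def wNorm {N : ℕ} (p : ℝ) (V : ℝ → ℝ≥0∞) (u : E N → ℝ) : ℝ :=
  (∫⁻ x, (‖weakGradient u x‖ₑ ^ p + V ‖x‖ * ‖u x‖ₑ ^ p)).toReal ^ (1 / p)

/-- The supremum of `∫_A K(|x|) |u|^{q-1} |h| dx` over `u ∈ W_r`, `h ∈ W`, `‖u‖ = ‖h‖ = 1`. -/
def supR {N : ℕ} (p : ℝ) (V : ℝ → ℝ≥0∞) (K : ℝ → ℝ) (q : ℝ) (A : Set (E N)) : ℝ≥0∞ :=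
  ⨆ (u : E N → ℝ) (h : E N → ℝ)
    (_ : MemWr p V u ∧ MemW p V h ∧ wNorm p V u = 1 ∧ wNorm p V h = 1),
    ∫⁻ x in A, ENNReal.ofReal (K ‖x‖ * |u x| ^ (q - 1) * |h x|)

/-- `𝓡₀(q,R)`: the supremum over the ball `B_R`. -/
def R0 (N : ℕ) (p : ℝ) (V : ℝ → ℝ≥0∞) (K : ℝ → ℝ) (q R : ℝ) : ℝ≥0∞ :=
  supR p V K q (Metric.ball (0 : E N) R)

/-- `𝓡_∞(q,R)`: the supremum over `ℝ^N \ B_R`. -/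
def Rinf (N : ℕ) (p : ℝ) (V : ℝ → ℝ≥0∞) (K : ℝ → ℝ) (q R : ℝ) : ℝ≥0∞ :=
  supR p V K q (Metric.ball (0 : E N) R)ᶜ

/-- The condition `(𝓡'_{q₁,q₂})`. -/
def CondR (N : ℕ) (p : ℝ) (V : ℝ → ℝ≥0∞) (K : ℝ → ℝ) (q₁ q₂ : ℝ) : Prop :=
  ∃ R₁ R₂ : ℝ, 0 < R₁ ∧ 0 < R₂ ∧ R0 N p V K q₁ R₁ < ⊤ ∧ Rinf N p V K q₂ R₂ < ⊤

/-- `g : (0,∞) × ℝ → ℝ` is a Carathéodory function. -/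
def IsCaratheodory (g : ℝ → ℝ → ℝ) : Prop :=
  (∀ t : ℝ, AEMeasurable (fun r => g r t) (volume.restrict (Ioi (0 : ℝ)))) ∧
    ∀ᵐ r ∂(volume.restrict (Ioi (0 : ℝ))), Continuous (g r)

/-- The linear operator `h ↦ ∫ g(|x|,0) h dx` is (well defined and) continuous on the whole
space `W`. -/
def CondG0 (N : ℕ) (p : ℝ) (V : ℝ → ℝ≥0∞) (g : ℝ → ℝ → ℝ) : Prop :=
  (∀ h : E N → ℝ, MemW p V h → Integrable (fun x => g ‖x‖ 0 * h x)) ∧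
    ∃ C : ℝ, ∀ h : E N → ℝ, MemW p V h → |∫ x, g ‖x‖ 0 * h x| ≤ C * wNorm p V h

/-- The condition `(g)`. -/
def CondG (g : ℝ → ℝ → ℝ) (K f : ℝ → ℝ) : Prop :=
  ∀ᵐ r ∂(volume.restrict (Ioi (0 : ℝ))), ∀ t : ℝ, |g r t - g r 0| ≤ K r * |f t|

/-- The double-power growth condition `(f_{q₁,q₂})`. -/
def CondF (f : ℝ → ℝ) (q₁ q₂ : ℝ) : Prop :=
  ∃ M : ℝ, 0 < M ∧ ∀ t : ℝ, |f t| ≤ M * min (|t| ^ (q₁ - 1)) (|t| ^ (q₂ - 1))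

/-- The functional `I(u) = (1/p)‖u‖^p - ∫ G(|x|,u) dx`, where `G(r,t) = ∫_0^t g(r,τ) dτ`. -/
def functionalI {N : ℕ} (p : ℝ) (V : ℝ → ℝ≥0∞) (g : ℝ → ℝ → ℝ) (u : E N → ℝ) : ℝ :=
  (1 / p) * wNorm p V u ^ p - ∫ x, ∫ t in (0 : ℝ)..(u x), g ‖x‖ t

/-- `u` is a critical point of `I : W_r → ℝ`: `u ∈ W_r`, and `I` is Fréchet differentiable at `u`
as a functional on the normed space `(W_r, ‖·‖)` with derivative `I'(u) = 0`, which means that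
`I(u+h) - I(u) = o(‖h‖)` as `‖h‖ → 0`, `h ∈ W_r`. -/
def IsCriticalPoint {N : ℕ} (p : ℝ) (V : ℝ → ℝ≥0∞) (g : ℝ → ℝ → ℝ) (u : E N → ℝ) : Prop :=
  MemWr p V u ∧ ∀ ε : ℝ, 0 < ε → ∃ δ : ℝ, 0 < δ ∧ ∀ h : E N → ℝ, MemWr p V h →
    wNorm p V h < δ → |functionalI p V g (u + h) - functionalI p V g u| ≤ ε * wNorm p V h

/-- `u ∈ W_r` is a (radial) weak solution of the equation: for every `h ∈ W`, radial or not, the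
integrals exist and `∫ |∇u|^{p-2} ∇u·∇h + ∫ V(|x|)|u|^{p-2} u h = ∫ g(|x|,u) h`.
Since `u = 0` a.e. on `{V(|x|) = ∞}`, taking the real value of `V` there changes nothing. -/
def IsWeakSolution {N : ℕ} (p : ℝ) (V : ℝ → ℝ≥0∞) (g : ℝ → ℝ → ℝ) (u : E N → ℝ) : Prop :=
  MemWr p V u ∧ ∀ h : E N → ℝ, MemW p V h →
    Integrable (fun x =>
      ‖weakGradient u x‖ ^ (p - 2) * inner ℝ (weakGradient u x) (weakGradient h x)) ∧
    Integrable (fun x => (V ‖x‖).toReal * (|u x| ^ (p - 2) * u x * h x)) ∧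
    Integrable (fun x => g ‖x‖ (u x) * h x) ∧
    (∫ x, ‖weakGradient u x‖ ^ (p - 2) * inner ℝ (weakGradient u x) (weakGradient h x)) +
        ∫ x, (V ‖x‖).toReal * (|u x| ^ (p - 2) * u x * h x) =
      ∫ x, g ‖x‖ (u x) * h x

end PLap

end

/-! ### Weak gradients: uniqueness, linearity, isometries, mollification. -/

noncomputable section

namespace PLap

variable {N : ℕ}

/-! This is symmetric criticality in the sense of Palais, obtained by averaging test functions over
the orthogonal group O(N). Criticality in W_r gives the weak equation for radial test functions only
(`IsCriticalPoint.weak_equation_of_radial`). For h in W put h̄(x) = ∫ h(R⁻¹x) dR, with R distributed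
by the normalized Haar measure. Jensen's inequality places h̄ in W_r (`MemW.memWr_radialAverage`),
and its weak gradient is ∫ R ∇h(R⁻¹x) dR. Since u is radial, ∇u is rotation equivariant while
V(|x|)|u|^(p-2)u and g(|x|,u) are rotation invariant. Fubini and the substitution x = Ry then show
that each of the three integrals has the same value at h and at h̄ (`isWeakSolution_of_radial`).
Differentiability of I outside W_r plays no role.

The analytic input is that K(|x|) min(|w|^(q₁-1), |w|^(q₂-1)) |h| is integrable for w in W_r and
every h in W (`integrable_mul_minPow`). It makes g(|x|,u)h integrable and dominates the difference
quotients of I. Near the origin and near infinity the two suprema give it by homogeneity. On an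
intermediate annulus K is in L^s, h is in L^(p*) with s' ≤ p*, and w is bounded. That bound is
`HasWeakGradient.exists_bound_of_radial`: testing the weak gradient with fields χ(|x|)x controls all
weighted radial means of w uniformly, and concentrating the weights gives an a.e. pointwise bound.
-/

theorem hasWeakGradient_weakGradient {u : E N → ℝ} (h : ∃ G, HasWeakGradient u G) :
    HasWeakGradient u (weakGradient u) := by
  rw [weakGradient, dif_pos h]
  exact h.choose_spec

theorem HasWeakGradient.ae_unique {u : E N → ℝ} {G G' : E N → E N}
    (h : HasWeakGradient u G) (h' : HasWeakGradient u G') : G =ᵐ[volume] G' := by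
  have hL : LocallyIntegrable (G - G') := h.2.1.sub h'.2.1
  have key : ∀ᵐ x, (G - G') x = 0 := by
    refine ae_eq_zero_of_integral_contDiff_smul_eq_zero hL fun φ hφ hc => ?_
    have i1 : Integrable (fun x => φ x • G x) :=
      h.2.1.integrable_smul_left_of_hasCompactSupport hφ.continuous hc
    have i2 : Integrable (fun x => φ x • G' x) :=
      h'.2.1.integrable_smul_left_of_hasCompactSupport hφ.continuous hc
    refine ext_inner_left ℝ fun v => ?_
    have e : ∀ H : E N → E N, Integrable (fun x => φ x • H x) →
        inner ℝ v (∫ x, φ x • H x) = ∫ x, inner ℝ (H x) v * φ x := by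
      intro H hH
      rw [← integral_inner hH]
      refine integral_congr_ae (ae_of_all _ fun x => ?_)
      simp only [inner_smul_right, real_inner_comm]
      ring
    simp only [Pi.sub_apply, smul_sub]
    rw [integral_sub i1 i2, inner_sub_right, e _ i1, e _ i2, inner_zero_right, sub_eq_zero]
    exact neg_injective ((h.2.2 φ hφ hc v).symm.trans (h'.2.2 φ hφ hc v))
  filter_upwards [key] with x hx
  exact sub_eq_zero.1 hx

theorem HasWeakGradient.weakGradient_ae_eq {u : E N → ℝ} {G : E N → E N}
    (h : HasWeakGradient u G) : weakGradient u =ᵐ[volume] G :=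
  (hasWeakGradient_weakGradient ⟨G, h⟩).ae_unique h

theorem HasWeakGradient.congr {u u' : E N → ℝ} {G G' : E N → E N} (h : HasWeakGradient u G)
    (hu : u =ᵐ[volume] u') (hG : G =ᵐ[volume] G') : HasWeakGradient u' G' := by
  have hloc : ∀ {F : Type} [NormedAddCommGroup F] {f f' : E N → F},
      LocallyIntegrable f → f =ᵐ[volume] f' → LocallyIntegrable f' := by
    intro F _ f f' hf hff x
    obtain ⟨U, hU, hi⟩ := hf x
    exact ⟨U, hU, hi.congr (ae_restrict_of_ae hff)⟩
  refine ⟨hloc h.1 hu, hloc h.2.1 hG, fun φ hφ hc v => ?_⟩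
  have e1 : ∫ x, u' x * fderiv ℝ φ x v = ∫ x, u x * fderiv ℝ φ x v :=
    integral_congr_ae (by filter_upwards [hu] with x hx; rw [hx])
  have e2 : ∫ x, inner ℝ (G' x) v * φ x = ∫ x, inner ℝ (G x) v * φ x :=
    integral_congr_ae (by filter_upwards [hG] with x hx; rw [hx])
  rw [e1, e2, h.2.2 φ hφ hc v]

theorem HasWeakGradient.const_mul {u : E N → ℝ} {G : E N → E N} (h : HasWeakGradient u G)
    (c : ℝ) : HasWeakGradient (fun x => c * u x) (fun x => c • G x) := by
  refine ⟨h.1.smul c, h.2.1.smul c, fun φ hφ hc v => ?_⟩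
  have := h.2.2 φ hφ hc v
  simp only [inner_smul_left, mul_assoc, integral_const_mul, this]
  simp

theorem integrable_mul_fderiv {u φ : E N → ℝ} (hu : LocallyIntegrable u) (hφ : ContDiff ℝ ∞ φ)
    (hc : HasCompactSupport φ) (v : E N) : Integrable (fun x => u x * fderiv ℝ φ x v) := by
  refine hu.integrable_smul_right_of_hasCompactSupport
    ((hφ.continuous_fderiv (by simp)).clm_apply continuous_const) ?_
  exact hc.fderiv_apply (𝕜 := ℝ) v

theorem integrable_inner_mul {G : E N → E N} {φ : E N → ℝ} (hG : LocallyIntegrable G)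
    (hφ : Continuous φ) (hc : HasCompactSupport φ) (v : E N) :
    Integrable (fun x => inner ℝ (G x) v * φ x) := by
  have := (hG.integrable_smul_left_of_hasCompactSupport hφ hc).inner_const (𝕜 := ℝ) v
  refine this.congr (ae_of_all _ fun x => ?_)
  simp [inner_smul_left, mul_comm]

theorem HasWeakGradient.add {u w : E N → ℝ} {G H : E N → E N} (hu : HasWeakGradient u G)
    (hw : HasWeakGradient w H) : HasWeakGradient (u + w) (G + H) := by
  refine ⟨hu.1.add hw.1, hu.2.1.add hw.2.1, fun φ hφ hc v => ?_⟩
  have := hu.2.2 φ hφ hc v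
  have := hw.2.2 φ hφ hc v
  simp only [Pi.add_apply, inner_add_left, add_mul]
  rw [integral_add (integrable_mul_fderiv hu.1 hφ hc v) (integrable_mul_fderiv hw.1 hφ hc v),
    integral_add (integrable_inner_mul hu.2.1 hφ.continuous hc v)
      (integrable_inner_mul hw.2.1 hφ.continuous hc v)]
  linarith

/-- Change of variables by a linear isometry. -/
theorem HasWeakGradient.comp_linearIsometryEquiv {u : E N → ℝ} {G : E N → E N}
    (hu : HasWeakGradient u G) (R : E N ≃ₗᵢ[ℝ] E N) :
    HasWeakGradient (fun x => u (R.symm x)) (fun x => R (G (R.symm x))) := by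
  have hm := R.symm.measurePreserving
  have hloc : ∀ {F : Type} [NormedAddCommGroup F] {f : E N → F},
      LocallyIntegrable f → LocallyIntegrable (fun x => f (R.symm x)) := by
    intro F _ f hf x
    obtain ⟨U, hU, hi⟩ := hf (R.symm x)
    refine ⟨R.symm ⁻¹' U, R.symm.continuous.continuousAt hU, ?_⟩
    exact (hm.integrableOn_comp_preimage R.symm.toHomeomorph.measurableEmbedding).2 hi
  refine ⟨hloc hu.1, ?_, fun φ hφ hc v => ?_⟩
  · intro x
    obtain ⟨U, hU, hi⟩ := hloc hu.2.1 x
    exact ⟨U, hU, R.toLinearIsometry.toContinuousLinearMap.integrable_comp hi⟩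
  · have hcv : ∀ F : E N → ℝ, ∫ x, F x = ∫ y, F (R y) := fun F =>
      (R.measurePreserving.integral_comp R.toHomeomorph.measurableEmbedding F).symm
    have hφR : ContDiff ℝ ∞ (fun y => φ (R y)) := hφ.comp R.contDiff
    have hcR : HasCompactSupport (fun y => φ (R y)) := hc.comp_homeomorph R.toHomeomorph
    rw [hcv fun x => u (R.symm x) * fderiv ℝ φ x v,
      hcv fun x => inner ℝ (R (G (R.symm x))) v * φ x]
    simp only [LinearIsometryEquiv.symm_apply_apply]
    have h1 := hu.2.2 _ hφR hcR (R.symm v)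
    have hd : ∀ y, fderiv ℝ (fun y => φ (R y)) y (R.symm v) = fderiv ℝ φ (R y) v := by
      intro y
      have h2 : HasFDerivAt φ (fderiv ℝ φ (R y)) (R y) :=
        ((hφ.differentiable (by simp)) _).hasFDerivAt
      have := h2.comp y (R.toContinuousLinearEquiv.toContinuousLinearMap.hasFDerivAt (x := y))
      have e := this.fderiv
      change fderiv ℝ (fun y => φ (R y)) y = _ at e
      rw [e]
      simp
    simp only [hd] at h1
    rw [h1]
    congr 2
    ext y
    congr 1
    rw [← R.inner_map_map]
    simp

/-- A function with vanishing weak gradient is constant. -/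
theorem HasWeakGradient.ae_const_of_zero {u : E N → ℝ} (hu : HasWeakGradient u 0) :
    ∃ c : ℝ, u =ᵐ[volume] fun _ => c := by
  -- The radii have constant ratio 2, as required for a.e. convergence of the mollifications of a
  -- locally integrable function.
  let b : ℕ → ContDiffBump (0 : E N) := fun n =>
    { rIn := 1 / (n + 1), rOut := 2 / (n + 1), rIn_pos := by positivity
      rIn_lt_rOut := by gcongr; norm_num }
  have hlim : Filter.Tendsto (fun i => (b i).rOut) Filter.atTop (nhds 0) := by
    simpa [b, div_eq_mul_inv] using
      (tendsto_one_div_add_atTop_nhds_zero_nat (𝕜 := ℝ)).const_mul 2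
  have hae := ContDiffBump.ae_convolution_tendsto_right_of_locallyIntegrable (μ := volume)
    (φ := b) (K := 2) hlim (Filter.Eventually.of_forall fun i => le_of_eq (by simp [b]; ring)) hu.1
  have hconst : ∀ i, ∀ x y : E N,
      convolution ((b i).normed volume) u (ContinuousLinearMap.lsmul ℝ ℝ) volume x =
      convolution ((b i).normed volume) u (ContinuousLinearMap.lsmul ℝ ℝ) volume y := by
    intro i
    have hs : ContDiff ℝ ∞ ((b i).normed volume) := (b i).contDiff_normed
    have hcs : HasCompactSupport ((b i).normed volume) := (b i).hasCompactSupport_normed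
    have hd := fun x => hcs.hasFDerivAt_convolution_left (μ := volume)
      (ContinuousLinearMap.lsmul ℝ ℝ) (hs.of_le (by simp)) hu.1 x
    refine is_const_of_fderiv_eq_zero (𝕜 := ℝ) (fun x => (hd x).differentiableAt) fun x => ?_
    rw [(hd x).fderiv]
    ext v
    rw [convolution_eq_swap]
    have hi : Integrable fun t => ((ContinuousLinearMap.precompL (E N)
        (ContinuousLinearMap.lsmul ℝ ℝ : ℝ →L[ℝ] ℝ →L[ℝ] ℝ))
        (fderiv ℝ ((b i).normed volume) (x - t))) (u t) := by
      have := (hcs.fderiv ℝ).convolutionExists_left (ContinuousLinearMap.precompL (E N)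
        (ContinuousLinearMap.lsmul ℝ ℝ : ℝ →L[ℝ] ℝ →L[ℝ] ℝ)) (hs.continuous_fderiv (by simp))
        hu.1 x
      exact this.integrable_swap
    rw [ContinuousLinearMap.integral_apply hi]
    -- Up to sign, the derivative of the mollification at x is u paired with the derivative of the
    -- test function t ↦ b(x - t), which a zero weak gradient annihilates.
    have h0 := hu.2.2 (fun t => (b i).normed volume (x - t)) (hs.comp (contDiff_const.sub contDiff_id))
      (hcs.comp_homeomorph (Homeomorph.subLeft x)) v
    have hd2 : ∀ t, fderiv ℝ (fun t => (b i).normed volume (x - t)) t v =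
        - fderiv ℝ ((b i).normed volume) (x - t) v := by
      intro t
      have h2 : HasFDerivAt ((b i).normed volume) (fderiv ℝ ((b i).normed volume) (x - t)) (x - t) :=
        ((hs.differentiable (by simp)) _).hasFDerivAt
      have := h2.comp t ((hasFDerivAt_id t).const_sub x)
      have e := this.fderiv
      change fderiv ℝ (fun t => (b i).normed volume (x - t)) t = _ at e
      rw [e]; simp
    simp only [hd2, Pi.zero_apply, inner_zero_left, zero_mul, integral_zero, neg_zero, mul_neg,
      integral_neg, neg_eq_zero] at h0
    simpa [ContinuousLinearMap.precompL_apply, mul_comm] using h0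
  obtain ⟨x₀, hx₀⟩ := hae.exists
  refine ⟨u x₀, ?_⟩
  filter_upwards [hae] with x hx
  refine tendsto_nhds_unique hx ?_
  simpa only [hconst _ x x₀] using hx₀

theorem weakGradient_add {u w : E N → ℝ} (hu : ∃ G, HasWeakGradient u G)
    (hw : ∃ G, HasWeakGradient w G) :
    weakGradient (u + w) =ᵐ[volume] weakGradient u + weakGradient w :=
  ((hasWeakGradient_weakGradient hu).add (hasWeakGradient_weakGradient hw)).weakGradient_ae_eq

theorem weakGradient_const_mul {u : E N → ℝ} (hu : ∃ G, HasWeakGradient u G) (c : ℝ) :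
    weakGradient (fun x => c * u x) =ᵐ[volume] fun x => c • weakGradient u x :=
  ((hasWeakGradient_weakGradient hu).const_mul c).weakGradient_ae_eq

end PLap

end

/-! ### Polar coordinates and boundedness of radial functions on annuli. -/

noncomputable section

namespace PLap

variable {N : ℕ}

/-- Null sets of `(0,∞)` pull back to null sets of `ℝ^N` under the norm. -/
theorem quasiMeasurePreserving_norm [Nontrivial (E N)] :
    Measure.QuasiMeasurePreserving (fun x : E N => ‖x‖) volume (volume.restrict (Ioi (0 : ℝ))) := by
  refine ⟨measurable_norm, ?_⟩
  refine Measure.AbsolutelyContinuous.mk fun s hs h0 => ?_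
  rw [Measure.map_apply measurable_norm hs]
  have hae : ∀ᵐ y ∂(volume.restrict (Ioi (0 : ℝ))), s.indicator (fun _ => (1 : ℝ)) y = 0 := by
    rw [← compl_mem_ae_iff] at h0
    filter_upwards [h0] with y hy
    exact indicator_of_notMem hy _
  -- Integrability has to come first: a vanishing integral says nothing about a nonintegrable
  -- function, whose integral is 0 by default.
  have hi : Integrable (fun x : E N => s.indicator (fun _ => (1 : ℝ)) ‖x‖) := by
    rw [integrable_fun_norm_addHaar volume (f := s.indicator (fun _ => (1 : ℝ)))]
    refine (integrable_zero ℝ ℝ _).congr ?_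
    filter_upwards [hae] with y hy
    simp [hy]
  have hint : ∫ x : E N, s.indicator (fun _ => (1 : ℝ)) ‖x‖ = 0 := by
    rw [integral_fun_norm_addHaar volume (s.indicator (fun _ => (1 : ℝ)))]
    have : ∫ y in Ioi (0 : ℝ), y ^ (Module.finrank ℝ (E N) - 1) •
        s.indicator (fun _ => (1 : ℝ)) y = 0 := by
      refine integral_eq_zero_of_ae ?_
      filter_upwards [hae] with y hy
      simp [hy]
    rw [this, smul_zero, smul_zero]
  rw [integral_eq_zero_iff_of_nonneg (fun x => indicator_nonneg (by simp) _) hi] at hint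
  rw [← compl_mem_ae_iff]
  filter_upwards [hint] with x hx hxs
  simp [indicator_of_mem (show ‖x‖ ∈ s from hxs)] at hx

/-- Vanishing of χ below α > 0 hides the singularity of the norm at the origin. -/
theorem contDiff_comp_norm {χ : ℝ → ℝ} (hχ : ContDiff ℝ ∞ χ) {α : ℝ} (hα : 0 < α)
    (h0 : ∀ r < α, χ r = 0) : ContDiff ℝ ∞ fun x : E N => χ ‖x‖ := by
  rw [contDiff_iff_contDiffAt]
  intro x
  by_cases hx : x = 0
  · have : (fun x : E N => χ ‖x‖) =ᶠ[nhds x] fun _ => 0 := by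
      filter_upwards [Metric.ball_mem_nhds x hα] with y hy
      exact h0 _ (by simpa [hx] using hy)
    exact contDiffAt_const.congr_of_eventuallyEq this
  · exact hχ.contDiffAt.comp x (contDiffAt_norm ℝ hx)

theorem hasFDerivAt_norm_of_ne_zero {H : Type*} [NormedAddCommGroup H] [InnerProductSpace ℝ H]
    {x : H} (hx : x ≠ 0) : HasFDerivAt (fun x : H => ‖x‖) (‖x‖⁻¹ • innerSL ℝ x) x := by
  have hxn : ‖x‖ ≠ 0 := norm_ne_zero_iff.2 hx
  have h4 := (hasStrictFDerivAt_norm_sq x).hasFDerivAt.sqrt (by positivity)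
  have h5 : (fun y : H => √(‖y‖ ^ 2)) = fun y => ‖y‖ := by
    ext y; exact Real.sqrt_sq (norm_nonneg y)
  rw [h5] at h4
  refine h4.congr_fderiv ?_
  rw [Real.sqrt_sq (norm_nonneg x)]
  ext w
  simp
  field_simp

theorem fderiv_comp_norm {χ : ℝ → ℝ} (hχ : ContDiff ℝ ∞ χ) {α : ℝ} (hα : 0 < α)
    (h0 : ∀ r < α, χ r = 0) (x v : E N) :
    fderiv ℝ (fun x : E N => χ ‖x‖) x v = deriv χ ‖x‖ * (inner ℝ x v / ‖x‖) := by
  by_cases hx : x = 0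
  · have : (fun x : E N => χ ‖x‖) =ᶠ[nhds x] fun _ => 0 := by
      filter_upwards [Metric.ball_mem_nhds x hα] with y hy
      exact h0 _ (by simpa [hx] using hy)
    rw [this.fderiv_eq]
    simp [hx]
  · have h1 : HasDerivAt χ (deriv χ ‖x‖) ‖x‖ := ((hχ.differentiable (by simp)) _).hasDerivAt
    have h3 := hasFDerivAt_norm_of_ne_zero hx
    have := (h1.comp_hasFDerivAt x h3).fderiv
    change fderiv ℝ (fun x : E N => χ ‖x‖) x = _ at this
    rw [this]
    simp only [smul_apply, innerSL_apply_apply, smul_eq_mul]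
    ring

/-- The divergence identity tested with the radial field `χ(|x|) x`. -/
theorem HasWeakGradient.integral_radial_field {u : E N → ℝ} {G : E N → E N}
    (hu : HasWeakGradient u G) {χ : ℝ → ℝ} (hχ : ContDiff ℝ ∞ χ) {α β : ℝ} (hα : 0 < α)
    (h0 : ∀ r < α, χ r = 0) (h1 : ∀ r, β < r → χ r = 0) :
    ∫ x, u x * (‖x‖ * deriv χ ‖x‖ + N * χ ‖x‖) = - ∫ x, inner ℝ (G x) x * χ ‖x‖ := by
  -- Each component χ(|x|)xᵢ is tested in direction eᵢ; the sum over i produces the divergence |x|χ'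
  -- + Nχ.
  let e : Fin N → E N := fun i => EuclideanSpace.single i 1
  let Φ : Fin N → E N → ℝ := fun i x => χ ‖x‖ * x i
  have hcoord : ∀ i, ContDiff ℝ ∞ (fun x : E N => x i) := fun i =>
    (EuclideanSpace.proj (𝕜 := ℝ) i : E N →L[ℝ] ℝ).contDiff
  have hΦ : ∀ i, ContDiff ℝ ∞ (Φ i) := fun i => (contDiff_comp_norm hχ hα h0).mul (hcoord i)
  have hc : ∀ i, HasCompactSupport (Φ i) := fun i => by
    refine HasCompactSupport.intro (isCompact_closedBall (0 : E N) β) fun x hx => ?_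
    have : β < ‖x‖ := by simpa using hx
    simp [Φ, h1 _ this]
  have hd : ∀ i x, fderiv ℝ (Φ i) x (e i) = deriv χ ‖x‖ * (x i * x i / ‖x‖) + χ ‖x‖ := by
    intro i x
    have a1 : HasFDerivAt (fun x : E N => χ ‖x‖) (fderiv ℝ (fun x : E N => χ ‖x‖) x) x :=
      (((contDiff_comp_norm hχ hα h0).differentiable (by simp)) x).hasFDerivAt
    have a2 : HasFDerivAt (fun x : E N => x i) (EuclideanSpace.proj (𝕜 := ℝ) i : E N →L[ℝ] ℝ) x :=
      (EuclideanSpace.proj (𝕜 := ℝ) i : E N →L[ℝ] ℝ).hasFDerivAt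
    have := (a1.mul a2).fderiv
    change fderiv ℝ (Φ i) x = _ at this
    rw [this]
    simp [fderiv_comp_norm hχ hα h0, e, EuclideanSpace.inner_single_right]
    ring
  have hsum : ∑ i, ∫ x, u x * fderiv ℝ (Φ i) x (e i) = - ∑ i, ∫ x, inner ℝ (G x) (e i) * Φ i x := by
    rw [← Finset.sum_neg_distrib]
    exact Finset.sum_congr rfl fun i _ => hu.2.2 _ (hΦ i) (hc i) (e i)
  rw [← integral_finsetSum _ fun i _ => integrable_mul_fderiv hu.1 (hΦ i) (hc i) (e i),
    ← integral_finsetSum _ fun i _ =>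
      integrable_inner_mul hu.2.1 (hΦ i).continuous (hc i) (e i)] at hsum
  have hnorm : ∀ x : E N, ∑ i, x i * x i = ‖x‖ ^ 2 := fun x => by
    rw [EuclideanSpace.norm_sq_eq]
    simp [sq]
  convert hsum using 2
  · ext x
    simp only [hd, ← Finset.mul_sum, Finset.sum_add_distrib, ← Finset.sum_div, hnorm]
    congr 2
    · by_cases hx : x = 0
      · simp [hx]
      · have : ‖x‖ ≠ 0 := norm_ne_zero_iff.2 hx
        field_simp
    · simp
  · congr 1
    ext x
    simp only [e, Φ, PiLp.inner_apply, Finset.sum_mul]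
    refine Finset.sum_congr rfl fun i _ => ?_
    simp
    ring

/-- In the divergence identity only one term contains χ'. The others involve χ itself, integrated
over a fixed ball, so they are controlled by sup |χ| alone, with no loss in the derivative. -/
theorem HasWeakGradient.exists_bound_radial_field {u : E N → ℝ} {G : E N → E N}
    (hu : HasWeakGradient u G) {α β : ℝ} (hα : 0 < α) :
    ∃ C : ℝ, ∀ χ : ℝ → ℝ, ContDiff ℝ ∞ χ → (∀ r < α, χ r = 0) → (∀ r, β < r → χ r = 0) →
      ∀ B : ℝ, (∀ r, |χ r| ≤ B) → |∫ x, u x * (‖x‖ * deriv χ ‖x‖)| ≤ C * B := by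
  have iu : IntegrableOn u (Metric.closedBall 0 β) :=
    hu.1.integrableOn_isCompact (isCompact_closedBall _ _)
  have iG : IntegrableOn (fun x => inner ℝ (G x) x) (Metric.closedBall 0 β) := by
    have h1 : IntegrableOn (fun x => β * ‖G x‖) (Metric.closedBall 0 β) :=
      ((hu.2.1.integrableOn_isCompact (isCompact_closedBall _ _)).norm).const_mul β
    refine h1.mono' ((hu.2.1.aestronglyMeasurable.inner aestronglyMeasurable_id).restrict) ?_
    filter_upwards [ae_restrict_mem Metric.isClosed_closedBall.measurableSet] with x hx
    have hx' : ‖x‖ ≤ β := by simpa using hx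
    calc ‖inner ℝ (G x) x‖ ≤ ‖G x‖ * ‖x‖ := norm_inner_le_norm _ _
      _ ≤ ‖G x‖ * β := by gcongr
      _ = _ := mul_comm _ _
  refine ⟨(∫ x in Metric.closedBall 0 β, |inner ℝ (G x) x|) +
    N * ∫ x in Metric.closedBall 0 β, |u x|, fun χ hχ h0 h1 B hB => ?_⟩
  have hsupp : ∀ x : E N, x ∉ Metric.closedBall (0 : E N) β → χ ‖x‖ = 0 := fun x hx =>
    h1 _ (by simpa using hx)
  have hsm := contDiff_comp_norm (N := N) hχ hα h0
  have hcs : HasCompactSupport fun x : E N => χ ‖x‖ :=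
    HasCompactSupport.intro (isCompact_closedBall (0 : E N) β) hsupp
  have bnd : ∀ F : E N → ℝ, IntegrableOn F (Metric.closedBall 0 β) →
      |∫ x, F x * χ ‖x‖| ≤ (∫ x in Metric.closedBall 0 β, |F x|) * B := by
    intro F hF
    rw [← setIntegral_eq_integral_of_forall_compl_eq_zero (s := Metric.closedBall 0 β)
      (fun x hx => by rw [hsupp x hx, mul_zero]), ← integral_mul_const, ← Real.norm_eq_abs]
    refine norm_integral_le_of_norm_le (hF.abs.mul_const B) (ae_of_all _ fun x => ?_)
    rw [norm_mul]
    exact mul_le_mul_of_nonneg_left (hB _) (norm_nonneg _)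
  have i2 : Integrable fun x => u x * (N * χ ‖x‖) := by
    have := (hu.1.integrable_smul_right_of_hasCompactSupport hsm.continuous hcs).const_mul (N : ℝ)
    refine this.congr (ae_of_all _ fun x => ?_)
    simp
    ring
  have hds : ∀ x : E N, x ∉ Metric.closedBall (0 : E N) β → deriv χ ‖x‖ = 0 := by
    intro x hx
    have hx' : β < ‖x‖ := by simpa using hx
    have : χ =ᶠ[nhds ‖x‖] fun _ => 0 := by
      filter_upwards [lt_mem_nhds hx'] with r hr using h1 r hr
    rw [this.deriv_eq]
    simp
  have i1 : Integrable fun x => u x * (‖x‖ * deriv χ ‖x‖) := by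
    refine hu.1.integrable_smul_right_of_hasCompactSupport
      (g := fun x : E N => ‖x‖ * deriv χ ‖x‖) ?_ ?_
    · exact continuous_norm.mul ((hχ.continuous_deriv (by simp)).comp continuous_norm)
    · exact HasCompactSupport.intro (isCompact_closedBall (0 : E N) β) fun x hx => by
        rw [hds x hx, mul_zero]
  have key := hu.integral_radial_field hχ hα h0 h1
  simp only [mul_add] at key
  rw [integral_add i1 i2] at key
  have e2 : ∫ x, u x * (N * χ ‖x‖) = N * ∫ x, u x * χ ‖x‖ := by
    rw [← integral_const_mul]
    congr 1
    ext x
    ring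
  have b1 := bnd _ iG
  have b2 := bnd _ iu
  have : ∫ x, u x * (‖x‖ * deriv χ ‖x‖) =
      -(∫ x, inner ℝ (G x) x * χ ‖x‖) - N * ∫ x, u x * χ ‖x‖ := by rw [← e2]; linarith
  rw [this]
  calc |-(∫ x, inner ℝ (G x) x * χ ‖x‖) - N * ∫ x, u x * χ ‖x‖|
      ≤ |∫ x, inner ℝ (G x) x * χ ‖x‖| + N * |∫ x, u x * χ ‖x‖| := by
        refine (abs_sub _ _).trans ?_
        rw [abs_neg, abs_mul, Nat.abs_cast]
    _ ≤ _ := by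
        rw [add_mul, mul_assoc]
        gcongr

/-- Compare η with a fixed reference density θ. Since η - θ has mean zero, its primitive χ vanishes
outside [α, β], and |χ| ≤ ‖η‖₁ + ‖θ‖₁ = 2 whatever η is. Thus the means against η and θ differ by a
bounded amount. -/
theorem HasWeakGradient.exists_bound_radial_average {u : E N → ℝ} {G : E N → E N}
    (hu : HasWeakGradient u G) {α β : ℝ} (hα : 0 < α) (hαβ : α < β) :
    ∃ C : ℝ, ∀ η : ℝ → ℝ, ContDiff ℝ ∞ η → (∀ r, 0 ≤ η r) → (∀ r ∉ Icc α β, η r = 0) →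
      ∫ r, η r = 1 → |∫ x, u x * (‖x‖ * η ‖x‖)| ≤ C := by
  obtain ⟨C, hC⟩ := hu.exists_bound_radial_field (β := β) hα
  let b : ContDiffBump ((α + β) / 2) :=
    { rIn := (β - α) / 4, rOut := (β - α) / 2, rIn_pos := by linarith
      rIn_lt_rOut := by linarith }
  let θ : ℝ → ℝ := b.normed volume
  have hθ : ContDiff ℝ ∞ θ := b.contDiff_normed
  have hθ0 : ∀ r ∉ Icc α β, θ r = 0 := by
    intro r hr
    by_contra hne
    have h1 : r ∈ Function.support θ := hne
    rw [b.support_normed_eq, Real.ball_eq_Ioo, show b.rOut = (β - α) / 2 from rfl] at h1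
    exact hr ⟨by linarith [h1.1], by linarith [h1.2]⟩
  have hθ1 : ∫ r, θ r = 1 := b.integral_normed
  have hθi : Integrable θ := b.integrable_normed
  refine ⟨C * 2 + |∫ x, u x * (‖x‖ * θ ‖x‖)|, fun η hη hη0 hηs hη1 => ?_⟩
  have hηi : Integrable η := by
    refine hη.continuous.integrable_of_hasCompactSupport
      (HasCompactSupport.intro (isCompact_Icc (a := α) (b := β)) hηs)
  let χ : ℝ → ℝ := fun r => ∫ t in α..r, (η t - θ t)
  have hdc : Continuous fun t => η t - θ t := hη.continuous.sub hθ.continuous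
  have hd : ∀ r, HasDerivAt χ (η r - θ r) r := fun r => hdc.integral_hasStrictDerivAt α r |>.hasDerivAt
  have hdχ : deriv χ = fun r => η r - θ r := funext fun r => (hd r).deriv
  have hχ : ContDiff ℝ ∞ χ := by
    rw [contDiff_infty_iff_deriv]
    exact ⟨fun r => (hd r).differentiableAt, by rw [hdχ]; exact hη.sub hθ⟩
  have hlow : ∀ r < α, χ r = 0 := by
    intro r hr
    change ∫ t in α..r, (η t - θ t) = 0
    rw [intervalIntegral.integral_symm, neg_eq_zero]
    rw [intervalIntegral.integral_of_le hr.le, ← integral_Ioc_eq_integral_Ioo.symm]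
    refine setIntegral_eq_zero_of_forall_eq_zero fun t ht => ?_
    rw [hηs t fun h => absurd h.1 (not_le.2 ht.2), hθ0 t fun h => absurd h.1 (not_le.2 ht.2), sub_zero]
  have hhigh : ∀ r, β < r → χ r = 0 := by
    intro r hr
    change ∫ t in α..r, (η t - θ t) = 0
    rw [intervalIntegral.integral_of_le (hαβ.trans hr).le, ← integral_Icc_eq_integral_Ioc,
      setIntegral_eq_integral_of_forall_compl_eq_zero, integral_sub hηi hθi, hη1, hθ1, sub_self]
    intro t ht
    have : t ∉ Icc α β := fun h => ht ⟨h.1, h.2.trans hr.le⟩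
    rw [hηs t this, hθ0 t this, sub_zero]
  have hB : ∀ r, |χ r| ≤ 2 := by
    intro r
    calc |χ r| ≤ ∫ t in uIoc α r, ‖η t - θ t‖ := by
          rw [← Real.norm_eq_abs]
          exact intervalIntegral.norm_integral_le_integral_norm_uIoc
      _ ≤ ∫ t, ‖η t - θ t‖ := setIntegral_le_integral (hηi.sub hθi).norm (ae_of_all _ fun _ => norm_nonneg _)
      _ ≤ ∫ t, (η t + θ t) := by
          refine integral_mono (hηi.sub hθi).norm (hηi.add hθi) fun t => ?_
          refine (norm_sub_le _ _).trans (le_of_eq ?_)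
          rw [Real.norm_of_nonneg (hη0 t), Real.norm_of_nonneg (b.nonneg_normed t)]
      _ = 2 := by rw [integral_add hηi hθi, hη1, hθ1]; norm_num
  have key := hC χ hχ hlow hhigh 2 hB
  rw [hdχ] at key
  have hint : ∀ ζ : ℝ → ℝ, Continuous ζ → (∀ r ∉ Icc α β, ζ r = 0) →
      Integrable fun x => u x * (‖x‖ * ζ ‖x‖) := by
    intro ζ hζ hζs
    refine hu.1.integrable_smul_right_of_hasCompactSupport (g := fun x : E N => ‖x‖ * ζ ‖x‖)
      (continuous_norm.mul (hζ.comp continuous_norm)) ?_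
    refine HasCompactSupport.intro (isCompact_closedBall (0 : E N) β) fun x hx => ?_
    rw [hζs _ fun h => hx (by simpa using h.2), mul_zero]
  have e : ∫ x, u x * (‖x‖ * (η ‖x‖ - θ ‖x‖)) =
      (∫ x, u x * (‖x‖ * η ‖x‖)) - ∫ x, u x * (‖x‖ * θ ‖x‖) := by
    rw [← integral_sub (hint η hη.continuous hηs) (hint θ hθ.continuous hθ0)]
    congr 1
    ext x
    ring
  rw [e] at key
  have := abs_sub_abs_le_abs_sub (∫ x, u x * (‖x‖ * η ‖x‖)) (∫ x, u x * (‖x‖ * θ ‖x‖))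
  linarith

/-- A radial function with a locally integrable weak gradient is bounded on annuli. -/
theorem HasWeakGradient.exists_bound_of_radial [Nontrivial (E N)] {u : E N → ℝ} {G : E N → E N}
    (hu : HasWeakGradient u G) (hr : IsRadial u) {a b : ℝ} (ha : 0 < a) :
    ∃ C : ℝ, ∀ᵐ x, ‖x‖ ∈ Icc a b → |u x| ≤ C := by
  obtain ⟨φ, hφ⟩ := hr
  -- The interval is enlarged so that [a, b] lies in the interior of [α, β], with α < β even when b
  -- < a.
  set α := a / 2 with hαd
  set β := max a b + 1 with hβd
  have hα : 0 < α := by positivity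
  have hαβ : α < β := by
    have := le_max_left a b
    rw [hαd, hβd]; linarith
  obtain ⟨C, hC⟩ := hu.exists_bound_radial_average hα hαβ
  set n := Module.finrank ℝ (E N) with hn
  have hn1 : 0 < n := Module.finrank_pos
  set c : ℝ := n • (volume.real (Metric.ball (0 : E N) 1)) with hc
  have hcpos : 0 < c := by
    have : 0 < volume.real (Metric.ball (0 : E N) 1) :=
      ENNReal.toReal_pos (Metric.measure_ball_pos _ _ one_pos).ne' measure_ball_lt_top.ne
    rw [hc, nsmul_eq_mul]
    positivity
  -- In polar coordinates ∫ u |x| η(|x|) dx = c ∫ η f, where f(r) = rⁿ φ(r) on [α, β].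
  let F : ℝ → ℝ := (Icc α β).indicator fun y => φ y * y
  let f : ℝ → ℝ := (Ioi (0 : ℝ)).indicator fun y => y ^ (n - 1) * F y
  have hF : Integrable fun x : E N => F ‖x‖ := by
    have h1 : IntegrableOn (fun x => u x * ‖x‖) (Metric.closedBall (0 : E N) β) := by
      have h2 : LocallyIntegrable fun x => u x * ‖x‖ := by
        refine locallyIntegrable_iff.2 fun k hk => ?_
        exact (hu.1.integrableOn_isCompact hk).mul_continuousOn continuous_norm.continuousOn hk
      exact h2.integrableOn_isCompact (isCompact_closedBall _ _)
    have hms : MeasurableSet {x : E N | ‖x‖ ∈ Icc α β} := measurable_norm measurableSet_Icc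
    have h2 : IntegrableOn (fun x => u x * ‖x‖) {x : E N | ‖x‖ ∈ Icc α β} :=
      h1.mono_set fun x hx => by simpa using hx.2
    refine (h2.integrable_indicator hms).congr ?_
    filter_upwards [hφ] with x hx
    by_cases h : ‖x‖ ∈ Icc α β
    · rw [indicator_of_mem (show x ∈ {x : E N | ‖x‖ ∈ Icc α β} from h)]
      simp only [F]
      rw [indicator_of_mem h, hx]
    · rw [indicator_of_notMem (show x ∉ {x : E N | ‖x‖ ∈ Icc α β} from h)]
      simp only [F]
      rw [indicator_of_notMem h]
  have hf : Integrable f := by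
    rw [integrable_indicator_iff measurableSet_Ioi]
    exact (integrable_fun_norm_addHaar volume (f := F)).1 hF
  let bp : ℕ → ContDiffBump (0 : ℝ) := fun n =>
    { rIn := 1 / (n + 1), rOut := 2 / (n + 1), rIn_pos := by positivity
      rIn_lt_rOut := by gcongr; norm_num }
  have hlim : Filter.Tendsto (fun i => (bp i).rOut) Filter.atTop (nhds 0) := by
    simpa [bp, div_eq_mul_inv] using
      (tendsto_one_div_add_atTop_nhds_zero_nat (𝕜 := ℝ)).const_mul 2
  have hae := ContDiffBump.ae_convolution_tendsto_right_of_locallyIntegrable (μ := volume)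
    (φ := bp) (K := 2) hlim (Filter.Eventually.of_forall fun i => le_of_eq (by simp [bp]; ring))
    hf.locallyIntegrable
  -- Mollifiers concentrating at y are eventually admissible densities, so the uniform bound on
  -- averages passes to f(y) for a.e. y.
  have hbound : ∀ᵐ y : ℝ, y ∈ Ioo α β → |f y| ≤ C / c := by
    filter_upwards [hae] with y hy hyI
    refine le_of_tendsto hy.abs ?_
    have hev : ∀ᶠ i in Filter.atTop, (bp i).rOut < min (y - α) (β - y) :=
      hlim.eventually (gt_mem_nhds (lt_min (sub_pos.2 hyI.1) (sub_pos.2 hyI.2)))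
    filter_upwards [hev] with i hi
    rw [convolution_eq_swap]
    let η : ℝ → ℝ := fun t => (bp i).normed volume (y - t)
    have hηs : ∀ r ∉ Icc α β, η r = 0 := by
      intro r hr
      by_contra hne
      have h1 : y - r ∈ Function.support ((bp i).normed volume) := hne
      rw [(bp i).support_normed_eq, mem_ball_zero_iff, Real.norm_eq_abs, abs_lt] at h1
      have := lt_min_iff.1 hi
      exact hr ⟨by linarith [h1.2], by linarith [h1.1]⟩
    have h1 := hC η ((bp i).contDiff_normed.comp (contDiff_const.sub contDiff_id))
      (fun r => (bp i).nonneg_normed _) hηs (by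
        change ∫ t, (bp i).normed volume (y - t) = 1
        rw [integral_sub_left_eq_self fun t => (bp i).normed volume t]
        exact (bp i).integral_normed)
    have h2 : ∫ x, u x * (‖x‖ * η ‖x‖) = c * ∫ t, η t * f t := by
      have e1 : ∫ x, u x * (‖x‖ * η ‖x‖) = ∫ x : E N, (fun y => F y * η y) ‖x‖ := by
        refine integral_congr_ae ?_
        filter_upwards [hφ] with x hx
        by_cases h : ‖x‖ ∈ Icc α β
        · simp only [F]
          rw [indicator_of_mem h, hx]
          ring
        · simp only [F]
          rw [indicator_of_notMem h, hηs _ h]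
          ring
      rw [e1, integral_fun_norm_addHaar volume fun y => F y * η y, hc, nsmul_eq_mul, nsmul_eq_mul,
        smul_eq_mul, ← mul_assoc, ← integral_indicator measurableSet_Ioi]
      congr 2
      ext t
      by_cases ht : t ∈ Ioi (0 : ℝ)
      · simp only [f]
        rw [indicator_of_mem ht, indicator_of_mem ht, smul_eq_mul]
        ring
      · simp only [f]
        rw [indicator_of_notMem ht, indicator_of_notMem ht, mul_zero]
    rw [h2, abs_mul, abs_of_pos hcpos] at h1
    rw [le_div_iff₀ hcpos, mul_comm]
    exact h1
  refine ⟨C / c / α ^ n, ?_⟩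
  have hpull := quasiMeasurePreserving_norm (N := N) |>.ae (ae_restrict_of_ae hbound)
  filter_upwards [hpull, hφ] with x hx hxφ hxI
  have hxα : α < ‖x‖ := by
    rw [hαd]; linarith [hxI.1]
  have hxβ : ‖x‖ < β := by
    rw [hβd]; linarith [hxI.2, le_max_right a b]
  have h1 := hx ⟨hxα, hxβ⟩
  have hpos : 0 < ‖x‖ := hα.trans hxα
  have h2 : f ‖x‖ = ‖x‖ ^ n * u x := by
    simp only [f, F]
    rw [indicator_of_mem (show ‖x‖ ∈ Ioi (0 : ℝ) from hpos),
      indicator_of_mem (show ‖x‖ ∈ Icc α β from ⟨hxα.le, hxβ.le⟩), ← hxφ]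
    obtain ⟨m, hm⟩ : ∃ m, n = m + 1 := ⟨n - 1, by omega⟩
    rw [hm, Nat.add_sub_cancel, pow_succ]
    ring
  rw [h2, abs_mul, abs_of_pos (by positivity)] at h1
  rw [le_div_iff₀ (by positivity), mul_comm]
  refine le_trans ?_ h1
  gcongr

end PLap

end

/-! ### The space W, its norm, and integrability of the growth bound. -/

noncomputable section

namespace PLap

variable {N : ℕ} {p : ℝ} {V : ℝ → ℝ≥0∞}

theorem one_lt_sobolevExponent (hp : 1 < p) (hpN : p < N) : 1 < sobolevExponent N p := by
  rw [sobolevExponent, lt_div_iff₀ (by linarith)]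
  nlinarith

theorem sobolevExponent_pos (hp : 1 < p) (hpN : p < N) : 0 < sobolevExponent N p :=
  zero_lt_one.trans (one_lt_sobolevExponent hp hpN)

theorem IsRadial.add {u w : E N → ℝ} (hu : IsRadial u) (hw : IsRadial w) : IsRadial (u + w) := by
  obtain ⟨φ, hφ⟩ := hu
  obtain ⟨ψ, hψ⟩ := hw
  refine ⟨φ + ψ, ?_⟩
  filter_upwards [hφ, hψ] with x h1 h2
  simp [h1, h2]

theorem IsRadial.const_mul {u : E N → ℝ} (hu : IsRadial u) (c : ℝ) :
    IsRadial fun x => c * u x := by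
  obtain ⟨φ, hφ⟩ := hu
  refine ⟨fun r => c * φ r, ?_⟩
  filter_upwards [hφ] with x h1
  rw [h1]

theorem MemD.add {u w : E N → ℝ} (hu : MemD p u) (hw : MemD p w) : MemD p (u + w) :=
  ⟨hu.1.add hw.1,
    ⟨_, (hasWeakGradient_weakGradient hu.2.1).add (hasWeakGradient_weakGradient hw.2.1)⟩,
    (hu.2.2.add hw.2.2).ae_eq (weakGradient_add hu.2.1 hw.2.1).symm⟩

theorem MemD.const_mul {u : E N → ℝ} (hu : MemD p u) (c : ℝ) : MemD p fun x => c * u x :=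
  ⟨hu.1.const_mul c, ⟨_, (hasWeakGradient_weakGradient hu.2.1).const_mul c⟩,
    (hu.2.2.const_smul c).ae_eq (weakGradient_const_mul hu.2.1 c).symm⟩

theorem MemW.aemeasurable {u : E N → ℝ} (hu : MemW p V u) : AEMeasurable u :=
  hu.1.1.1.aemeasurable

theorem MemW.aemeasurable_potential (hV : AEMeasurable fun x : E N => V ‖x‖) {u : E N → ℝ}
    (hu : MemW p V u) : AEMeasurable fun x => V ‖x‖ * ‖u x‖ₑ ^ p :=
  hV.mul (hu.aemeasurable.enorm.pow_const p)

theorem MemW.aemeasurable_grad {u : E N → ℝ} (hu : MemW p V u) :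
    AEMeasurable fun x => ‖weakGradient u x‖ₑ ^ p :=
  hu.1.2.2.1.enorm.pow_const p

theorem MemW.add (hp : 1 < p) (hV : AEMeasurable fun x : E N => V ‖x‖) {u w : E N → ℝ}
    (hu : MemW p V u) (hw : MemW p V w) : MemW p V (u + w) := by
  refine ⟨hu.1.add hw.1, ?_⟩
  have h2 : (2 : ℝ≥0∞) ^ (p - 1) ≠ ⊤ := ENNReal.rpow_ne_top_of_nonneg (by linarith) (by simp)
  calc ∫⁻ x, V ‖x‖ * ‖(u + w) x‖ₑ ^ p
      ≤ ∫⁻ x, 2 ^ (p - 1) * (V ‖x‖ * ‖u x‖ₑ ^ p + V ‖x‖ * ‖w x‖ₑ ^ p) := by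
        refine lintegral_mono fun x => ?_
        calc V ‖x‖ * ‖(u + w) x‖ₑ ^ p ≤ V ‖x‖ * (2 ^ (p - 1) * (‖u x‖ₑ ^ p + ‖w x‖ₑ ^ p)) := by
              gcongr
              exact (ENNReal.rpow_le_rpow (enorm_add_le _ _) (by linarith)).trans
                (ENNReal.rpow_add_le_mul_rpow_add_rpow _ _ hp.le)
          _ = _ := by ring
    _ = 2 ^ (p - 1) * ((∫⁻ x, V ‖x‖ * ‖u x‖ₑ ^ p) + ∫⁻ x, V ‖x‖ * ‖w x‖ₑ ^ p) := by
        rw [lintegral_const_mul' _ _ h2, lintegral_add_left' (hu.aemeasurable_potential hV)]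
    _ < ⊤ := ENNReal.mul_lt_top h2.lt_top (ENNReal.add_lt_top.2 ⟨hu.2, hw.2⟩)

theorem MemW.const_mul (hp : 1 < p) {u : E N → ℝ} (hu : MemW p V u) (c : ℝ) :
    MemW p V fun x => c * u x := by
  refine ⟨hu.1.const_mul c, ?_⟩
  have h2 : ‖c‖ₑ ^ p ≠ ⊤ := ENNReal.rpow_ne_top_of_nonneg (by linarith) (by simp)
  have e : ∀ x : E N, V ‖x‖ * ‖c * u x‖ₑ ^ p = ‖c‖ₑ ^ p * (V ‖x‖ * ‖u x‖ₑ ^ p) := fun x => by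
    rw [enorm_mul, ENNReal.mul_rpow_of_nonneg _ _ (by linarith)]
    ring
  simp only [e]
  rw [lintegral_const_mul' _ _ h2]
  exact ENNReal.mul_lt_top h2.lt_top hu.2

theorem MemWr.add (hp : 1 < p) (hV : AEMeasurable fun x : E N => V ‖x‖) {u w : E N → ℝ}
    (hu : MemWr p V u) (hw : MemWr p V w) : MemWr p V (u + w) :=
  ⟨hu.1.add hp hV hw.1, hu.2.add hw.2⟩

theorem MemWr.const_mul (hp : 1 < p) {u : E N → ℝ} (hu : MemWr p V u) (c : ℝ) :
    MemWr p V fun x => c * u x :=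
  ⟨hu.1.const_mul hp c, hu.2.const_mul c⟩

theorem MemW.lintegral_grad_lt_top (hp : 1 < p) {u : E N → ℝ} (hu : MemW p V u) :
    ∫⁻ x, ‖weakGradient u x‖ₑ ^ p < ⊤ := by
  have := lintegral_rpow_enorm_lt_top_of_eLpNorm_lt_top
    (ENNReal.ofReal_pos.2 (by linarith)).ne' ENNReal.ofReal_ne_top hu.1.2.2.2
  rwa [ENNReal.toReal_ofReal (by linarith)] at this

theorem MemW.lintegral_lt_top (hp : 1 < p) {u : E N → ℝ} (hu : MemW p V u) :
    ∫⁻ x, (‖weakGradient u x‖ₑ ^ p + V ‖x‖ * ‖u x‖ₑ ^ p) < ⊤ := by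
  rw [lintegral_add_left' hu.aemeasurable_grad]
  exact ENNReal.add_lt_top.2 ⟨hu.lintegral_grad_lt_top hp, hu.2⟩

theorem wNorm_nonneg (u : E N → ℝ) : 0 ≤ wNorm p V u :=
  Real.rpow_nonneg ENNReal.toReal_nonneg _

theorem MemW.wNorm_const_mul (hp : 1 < p) {u : E N → ℝ} (hu : MemW p V u) (c : ℝ) :
    wNorm p V (fun x => c * u x) = |c| * wNorm p V u := by
  have h2 : ‖c‖ₑ ^ p ≠ ⊤ := ENNReal.rpow_ne_top_of_nonneg (by linarith) (by simp)
  have e : ∫⁻ x, (‖weakGradient (fun x => c * u x) x‖ₑ ^ p + V ‖x‖ * ‖c * u x‖ₑ ^ p) =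
      ‖c‖ₑ ^ p * ∫⁻ x, (‖weakGradient u x‖ₑ ^ p + V ‖x‖ * ‖u x‖ₑ ^ p) := by
    rw [← lintegral_const_mul' _ _ h2]
    refine lintegral_congr_ae ?_
    filter_upwards [weakGradient_const_mul hu.1.2.1 c] with x hx
    rw [hx, enorm_mul, enorm_smul, ENNReal.mul_rpow_of_nonneg _ _ (by linarith),
      ENNReal.mul_rpow_of_nonneg _ _ (by linarith)]
    ring
  rw [wNorm, e, ENNReal.toReal_mul, Real.mul_rpow ENNReal.toReal_nonneg ENNReal.toReal_nonneg,
    ← ENNReal.toReal_rpow, toReal_enorm, Real.norm_eq_abs, one_div,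
    Real.rpow_rpow_inv (abs_nonneg c) (by linarith), wNorm, one_div]

/-- A zero gradient makes u constant, and a nonzero constant is not in L^(p*) because ℝ^N has
infinite measure. This covers the functions that cannot be normalized in the suprema. -/
theorem MemW.ae_eq_zero_of_wNorm_eq_zero (hp : 1 < p) (hpN : p < N) {u : E N → ℝ}
    (hu : MemW p V u) (h0 : wNorm p V u = 0) : u =ᵐ[volume] 0 := by
  have h1 : ∫⁻ x, (‖weakGradient u x‖ₑ ^ p + V ‖x‖ * ‖u x‖ₑ ^ p) = 0 := by
    rw [wNorm, Real.rpow_eq_zero ENNReal.toReal_nonneg (by positivity),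
      ENNReal.toReal_eq_zero_iff] at h0
    exact h0.resolve_right (hu.lintegral_lt_top hp).ne
  have h2 : ∫⁻ x, ‖weakGradient u x‖ₑ ^ p = 0 :=
    le_antisymm ((lintegral_mono fun x => le_self_add).trans_eq h1) bot_le
  rw [lintegral_eq_zero_iff' hu.aemeasurable_grad] at h2
  have h3 : weakGradient u =ᵐ[volume] 0 := by
    filter_upwards [h2] with x hx
    simpa [ENNReal.rpow_eq_zero_iff, show ¬ p < 0 by linarith, show 0 < p by linarith] using hx
  obtain ⟨c, hc⟩ := ((hasWeakGradient_weakGradient hu.1.2.1).congr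
    (ae_eq_refl u) h3).ae_const_of_zero
  have hm := hu.1.1.ae_eq hc
  have hN : 0 < N := by
    have : (0 : ℝ) < N := by linarith
    exact_mod_cast this
  have : Nonempty (Fin N) := ⟨⟨0, hN⟩⟩
  rw [memLp_const_iff (ENNReal.ofReal_pos.2 (sobolevExponent_pos hp hpN)).ne'
    ENNReal.ofReal_ne_top] at hm
  have hinf : (volume : Measure (E N)) univ = ⊤ := measure_univ_of_isAddLeftInvariant _
  rw [hinf] at hm
  filter_upwards [hc] with x hx
  rw [hx]
  simpa using hm

theorem toReal_potential (a : ℝ≥0∞) (b : ℝ) : (a * ‖b‖ₑ ^ p).toReal = a.toReal * |b| ^ p := by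
  rw [ENNReal.toReal_mul, ← ENNReal.toReal_rpow, toReal_enorm, Real.norm_eq_abs]

theorem MemW.integrable_grad (hp : 1 < p) {u : E N → ℝ} (hu : MemW p V u) :
    Integrable fun x => ‖weakGradient u x‖ ^ p := by
  have := integrable_toReal_of_lintegral_ne_top hu.aemeasurable_grad (hu.lintegral_grad_lt_top hp).ne
  simpa only [← ENNReal.toReal_rpow, toReal_enorm] using this

theorem MemW.integrable_potential (hV : AEMeasurable fun x : E N => V ‖x‖) {u : E N → ℝ}
    (hu : MemW p V u) : Integrable fun x => (V ‖x‖).toReal * |u x| ^ p := by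
  have := integrable_toReal_of_lintegral_ne_top (hu.aemeasurable_potential hV) hu.2.ne
  simpa only [toReal_potential] using this

theorem MemW.wNorm_rpow (hp : 1 < p) (hV : AEMeasurable fun x : E N => V ‖x‖) {u : E N → ℝ}
    (hu : MemW p V u) :
    wNorm p V u ^ p = ∫ x, (‖weakGradient u x‖ ^ p + (V ‖x‖).toReal * |u x| ^ p) := by
  have hm : AEMeasurable fun x => ‖weakGradient u x‖ₑ ^ p + V ‖x‖ * ‖u x‖ₑ ^ p :=
    hu.aemeasurable_grad.add (hu.aemeasurable_potential hV)
  -- A.e. finiteness allows `toReal` to be split over the sum; it forces u = 0 a.e. where V = ∞, so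
  -- the default real value 0 there is harmless.
  have hlt := ae_lt_top' hm (hu.lintegral_lt_top hp).ne
  rw [wNorm, one_div, Real.rpow_inv_rpow ENNReal.toReal_nonneg (by linarith)]
  rw [← integral_toReal hm hlt]
  refine integral_congr_ae ?_
  filter_upwards [hlt] with x hx
  have h12 := ENNReal.add_lt_top.1 hx
  rw [ENNReal.toReal_add h12.1.ne h12.2.ne, toReal_potential, ← ENNReal.toReal_rpow, toReal_enorm]

/-- The integral is homogeneous of degree q - 1 in u and 1 in h, so it reduces to unit norms. If
either norm is 0, the integrand vanishes a.e., using q > 1 for u. -/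
theorem lintegral_lt_top_of_supR (hp : 1 < p) (hpN : p < N) {K : ℝ → ℝ} {q : ℝ} (hq : 1 < q)
    {A : Set (E N)} (hR : supR p V K q A < ⊤) {u h : E N → ℝ} (hu : MemWr p V u)
    (hh : MemW p V h) : ∫⁻ x in A, ENNReal.ofReal (K ‖x‖ * |u x| ^ (q - 1) * |h x|) < ⊤ := by
  have hzero : ∀ F : E N → ℝ, F =ᵐ[volume] 0 → ∫⁻ x in A, ENNReal.ofReal (F x) < ⊤ := by
    intro F hF
    have : ∫⁻ x in A, ENNReal.ofReal (F x) = ∫⁻ x in A, 0 :=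
      lintegral_congr_ae (ae_restrict_of_ae (by filter_upwards [hF] with x hx; simp [hx]))
    simp [this]
  by_cases hu0 : wNorm p V u = 0
  · refine hzero _ ?_
    filter_upwards [hu.1.ae_eq_zero_of_wNorm_eq_zero hp hpN hu0] with x hx
    simp [hx, Real.zero_rpow (show q - 1 ≠ 0 by linarith)]
  by_cases hh0 : wNorm p V h = 0
  · refine hzero _ ?_
    filter_upwards [hh.ae_eq_zero_of_wNorm_eq_zero hp hpN hh0] with x hx
    simp [hx]
  set a := wNorm p V u with ha
  set b := wNorm p V h with hb
  have hapos : 0 < a := lt_of_le_of_ne (wNorm_nonneg u) (Ne.symm hu0)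
  have hbpos : 0 < b := lt_of_le_of_ne (wNorm_nonneg h) (Ne.symm hh0)
  have hle : ∫⁻ x in A, ENNReal.ofReal (K ‖x‖ * |a⁻¹ * u x| ^ (q - 1) * |b⁻¹ * h x|) ≤
      supR p V K q A := by
    refine le_iSup_of_le (fun x => a⁻¹ * u x) (le_iSup_of_le (fun x => b⁻¹ * h x)
      (le_iSup_of_le ⟨hu.const_mul hp _, hh.const_mul hp _, ?_, ?_⟩ le_rfl))
    · rw [hu.1.wNorm_const_mul hp, ← ha, abs_of_pos (inv_pos.2 hapos), inv_mul_cancel₀ hu0]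
    · rw [hh.wNorm_const_mul hp, ← hb, abs_of_pos (inv_pos.2 hbpos), inv_mul_cancel₀ hh0]
  have e : ∀ x : E N, ENNReal.ofReal (K ‖x‖ * |u x| ^ (q - 1) * |h x|) =
      ENNReal.ofReal (a ^ (q - 1) * b) *
        ENNReal.ofReal (K ‖x‖ * |a⁻¹ * u x| ^ (q - 1) * |b⁻¹ * h x|) := by
    intro x
    rw [← ENNReal.ofReal_mul (by positivity), abs_mul, abs_mul, abs_of_pos (inv_pos.2 hapos),
      abs_of_pos (inv_pos.2 hbpos), Real.mul_rpow (by positivity) (by positivity),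
      Real.inv_rpow hapos.le]
    congr 1
    have : a ^ (q - 1) ≠ 0 := (Real.rpow_pos_of_pos hapos _).ne'
    field_simp
  simp only [e]
  rw [lintegral_const_mul' _ _ ENNReal.ofReal_ne_top]
  exact ENNReal.mul_lt_top ENNReal.ofReal_lt_top (hle.trans_lt hR)

theorem aemeasurable_comp_norm [Nontrivial (E N)] {β : Type*} [MeasurableSpace β] {K : ℝ → β}
    (hK : AEMeasurable K (volume.restrict (Ioi (0 : ℝ)))) : AEMeasurable fun x : E N => K ‖x‖ :=
  hK.comp_quasiMeasurePreserving quasiMeasurePreserving_norm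

theorem ae_norm_pos [Nontrivial (E N)] : ∀ᵐ x : E N, 0 < ‖x‖ :=
  quasiMeasurePreserving_norm.ae (ae_restrict_mem measurableSet_Ioi)

theorem integrableOn_of_supR [Nontrivial (E N)] (hp : 1 < p) (hpN : p < N) {s : ℝ} {K : ℝ → ℝ}
    (hK : CondK s K) {q : ℝ} (hq : 1 < q) {A : Set (E N)} (hR : supR p V K q A < ⊤)
    {u h : E N → ℝ} (hu : MemWr p V u) (hh : MemW p V h) :
    IntegrableOn (fun x => K ‖x‖ * |u x| ^ (q - 1) * |h x|) A := by
  have hm : AEMeasurable fun x => K ‖x‖ * |u x| ^ (q - 1) * |h x| :=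
    ((aemeasurable_comp_norm hK.1).mul (hu.1.aemeasurable.norm.pow_const (q - 1))).mul
      hh.aemeasurable.norm
  refine ⟨hm.aestronglyMeasurable.restrict, ?_⟩
  rw [hasFiniteIntegral_iff_ofReal]
  · exact lintegral_lt_top_of_supR hp hpN hq hR hu hh
  · filter_upwards [ae_restrict_of_ae ae_norm_pos] with x hx
    have := hK.2.1 _ hx
    simp only [Pi.zero_apply]
    positivity

/-- On the annulus the polar weight r^(N-1) is at most b^(N-1), so the one-dimensional integrability
of K suffices. -/
theorem memLp_comp_norm_of_condK [Nontrivial (E N)] {s : ℝ} (hs1 : 1 < s) {K : ℝ → ℝ}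
    (hK : CondK s K) {a b : ℝ} (ha : 0 < a) (hab : a < b) :
    MemLp (fun x : E N => K ‖x‖) (ENNReal.ofReal s) (volume.restrict {x : E N | ‖x‖ ∈ Icc a b}) := by
  have hs0 : ENNReal.ofReal s ≠ 0 := (ENNReal.ofReal_pos.2 (by linarith)).ne'
  have hms : MeasurableSet {x : E N | ‖x‖ ∈ Icc a b} := measurable_norm measurableSet_Icc
  have h1 := hK.2.2 a b ha hab
  rw [← integrable_norm_rpow_iff h1.1 hs0 ENNReal.ofReal_ne_top] at h1
  rw [← integrable_norm_rpow_iff (aemeasurable_comp_norm hK.1).aestronglyMeasurable.restrict hs0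
    ENNReal.ofReal_ne_top]
  set t := (ENNReal.ofReal s).toReal
  change IntegrableOn (fun x : E N => ‖K ‖x‖‖ ^ t) {x : E N | ‖x‖ ∈ Icc a b}
  rw [← integrable_indicator_iff hms]
  have e : ({x : E N | ‖x‖ ∈ Icc a b}).indicator (fun x => ‖K ‖x‖‖ ^ t) =
      fun x => (Icc a b).indicator (fun y => ‖K y‖ ^ t) ‖x‖ := by
    ext x
    simp only [indicator, mem_ofPred_eq]
  rw [e, integrable_fun_norm_addHaar volume (f := (Icc a b).indicator fun y => ‖K y‖ ^ t)]
  have h2 : Integrable ((Icc a b).indicator fun y => ‖K y‖ ^ t) :=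
    (integrable_indicator_iff measurableSet_Icc).2 h1
  refine Integrable.integrableOn ?_
  refine (h2.norm.const_mul (b ^ (Module.finrank ℝ (E N) - 1))).mono'
    ((continuous_pow (Module.finrank ℝ (E N) - 1)).aestronglyMeasurable.smul h2.1) (ae_of_all _ fun y => ?_)
  by_cases hy : y ∈ Icc a b
  · rw [norm_smul, norm_pow, Real.norm_of_nonneg (ha.le.trans hy.1)]
    gcongr
    · exact ha.le.trans hy.1
    · exact hy.2
  · simp [indicator_of_notMem hy]

theorem integrableOn_annulus_mul [Nontrivial (E N)] (hp : 1 < p) (hpN : p < N) {s : ℝ}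
    (hs1 : 1 < s) (hs : N * p / (N * (p - 1) + p) < s) {K : ℝ → ℝ} (hK : CondK s K)
    {h : E N → ℝ} (hh : MemW p V h) {a b : ℝ} (ha : 0 < a) (hab : a < b) :
    IntegrableOn (fun x => K ‖x‖ * h x) {x : E N | ‖x‖ ∈ Icc a b} := by
  have hfin : IsFiniteMeasure (volume.restrict {x : E N | ‖x‖ ∈ Icc a b}) := by
    refine ⟨?_⟩
    rw [Measure.restrict_apply_univ]
    refine lt_of_le_of_lt (measure_mono fun x hx => ?_) (measure_closedBall_lt_top (x := (0 : E N)) (r := b))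
    simpa using hx.2
  have h1 := memLp_comp_norm_of_condK (N := N) hs1 hK ha hab
  have hconj := Real.HolderConjugate.conjExponent hs1
  -- Np/(N(p-1)+p) is the conjugate exponent of p*, so `hs` says s > (p*)', that is s' < p*. The
  -- annulus has finite measure, hence h ∈ L^(s') there and Hölder applies.
  have hle : s.conjExponent ≤ sobolevExponent N p := by
    have hN : (0 : ℝ) < N := by linarith
    have hpos : 0 < N * (p - 1) + p := by nlinarith
    rw [div_lt_iff₀ hpos] at hs
    rw [Real.conjExponent, sobolevExponent, div_le_div_iff₀ (by linarith) (by linarith)]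
    nlinarith
  have h2 : MemLp h (ENNReal.ofReal s.conjExponent) (volume.restrict {x : E N | ‖x‖ ∈ Icc a b}) :=
    (hh.1.1.restrict _).mono_exponent (ENNReal.ofReal_le_ofReal hle)
  have := hconj.ennrealOfReal
  exact h1.integrable_mul h2

/-- The double power `min (|t|^(q₁-1)) (|t|^(q₂-1))`. -/
def minPow (q₁ q₂ t : ℝ) : ℝ := min (|t| ^ (q₁ - 1)) (|t| ^ (q₂ - 1))

variable {q₁ q₂ : ℝ}

theorem minPow_nonneg (t : ℝ) : 0 ≤ minPow q₁ q₂ t :=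
  le_min (Real.rpow_nonneg (abs_nonneg _) _) (Real.rpow_nonneg (abs_nonneg _) _)

/-- The larger of |a|, |b| controls |t| up to a factor 2, and 2^(q₁+q₂) dominates both 2^(q₁-1) and
2^(q₂-1). -/
theorem minPow_le_of_abs_le_add (hq₁ : 1 < q₁) (hq₂ : 1 < q₂) {t a b : ℝ} (h : |t| ≤ |a| + |b|) :
    minPow q₁ q₂ t ≤ 2 ^ (q₁ + q₂) * (minPow q₁ q₂ a + minPow q₁ q₂ b) := by
  wlog hab : |a| ≤ |b| generalizing a b
  · rw [add_comm (minPow q₁ q₂ a)]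
    exact this (by rwa [add_comm]) (le_of_not_ge hab)
  have h2 : |t| ≤ 2 * |b| := by linarith
  have hpow : ∀ q : ℝ, 1 < q → q ≤ q₁ + q₂ → |t| ^ (q - 1) ≤ 2 ^ (q₁ + q₂) * |b| ^ (q - 1) := by
    intro q hq hle
    calc |t| ^ (q - 1) ≤ (2 * |b|) ^ (q - 1) :=
          Real.rpow_le_rpow (abs_nonneg _) h2 (by linarith)
      _ = 2 ^ (q - 1) * |b| ^ (q - 1) := Real.mul_rpow (by norm_num) (abs_nonneg _)
      _ ≤ _ := by
        gcongr
        · norm_num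
        · linarith
  have hb : minPow q₁ q₂ t ≤ 2 ^ (q₁ + q₂) * minPow q₁ q₂ b := by
    rw [minPow, minPow, mul_min_of_nonneg _ _ (by positivity)]
    exact min_le_min (hpow q₁ hq₁ (by linarith)) (hpow q₂ hq₂ (by linarith))
  refine hb.trans ?_
  gcongr
  linarith [minPow_nonneg (q₁ := q₁) (q₂ := q₂) a]

theorem integrable_mul_minPow [Nontrivial (E N)] (hp : 1 < p) (hpN : p < N) {s : ℝ}
    (hs1 : 1 < s) (hs : N * p / (N * (p - 1) + p) < s) {K : ℝ → ℝ} (hK : CondK s K)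
    (hq₁ : 1 < q₁) (hq₂ : 1 < q₂) (hR : CondR N p V K q₁ q₂) {w h : E N → ℝ}
    (hw : MemWr p V w) (hh : MemW p V h) :
    Integrable fun x => K ‖x‖ * (minPow q₁ q₂ (w x) * |h x|) := by
  obtain ⟨R₁, R₂, hR₁, hR₂, h1, h2⟩ := hR
  have hKm := aemeasurable_comp_norm (N := N) hK.1
  have hm : AEStronglyMeasurable fun x => K ‖x‖ * (minPow q₁ q₂ (w x) * |h x|) :=
    (hKm.mul (((hw.1.aemeasurable.norm.pow_const _).min
      (hw.1.aemeasurable.norm.pow_const _)).mul hh.aemeasurable.norm)).aestronglyMeasurable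
  have hn : ∀ x : E N, 0 < ‖x‖ → ‖K ‖x‖ * (minPow q₁ q₂ (w x) * |h x|)‖ =
      K ‖x‖ * minPow q₁ q₂ (w x) * |h x| := by
    intro x hx
    rw [norm_mul, norm_mul, Real.norm_of_nonneg (hK.2.1 _ hx).le,
      Real.norm_of_nonneg (minPow_nonneg _), Real.norm_eq_abs, abs_abs, mul_assoc]
  have i1 : IntegrableOn (fun x => K ‖x‖ * (minPow q₁ q₂ (w x) * |h x|))
      (Metric.ball (0 : E N) R₁) := by
    refine Integrable.mono' (integrableOn_of_supR hp hpN hK hq₁ h1 hw hh) hm.restrict ?_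
    filter_upwards [ae_restrict_of_ae ae_norm_pos] with x hx
    rw [hn x hx]
    have := (hK.2.1 _ hx).le
    gcongr
    exact min_le_left _ _
  have i2 : IntegrableOn (fun x => K ‖x‖ * (minPow q₁ q₂ (w x) * |h x|))
      (Metric.ball (0 : E N) R₂)ᶜ := by
    refine Integrable.mono' (integrableOn_of_supR hp hpN hK hq₂ h2 hw hh) hm.restrict ?_
    filter_upwards [ae_restrict_of_ae ae_norm_pos] with x hx
    rw [hn x hx]
    have := (hK.2.1 _ hx).le
    gcongr
    exact min_le_right _ _
  -- The outer radius R₁ + R₂ covers any gap between the ball and the exterior region and keeps the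
  -- annulus nondegenerate in either order of R₁, R₂.
  have i3 : IntegrableOn (fun x => K ‖x‖ * (minPow q₁ q₂ (w x) * |h x|))
      {x : E N | ‖x‖ ∈ Icc R₁ (R₁ + R₂)} := by
    obtain ⟨C, hC⟩ := (hasWeakGradient_weakGradient hw.1.1.2.1).exists_bound_of_radial hw.2
      (b := R₁ + R₂) hR₁
    have hi := integrableOn_annulus_mul hp hpN hs1 hs hK hh hR₁ (show R₁ < R₁ + R₂ by linarith)
    have hms : MeasurableSet {x : E N | ‖x‖ ∈ Icc R₁ (R₁ + R₂)} := measurable_norm measurableSet_Icc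
    refine Integrable.mono' (hi.norm.const_mul (C ^ (q₁ - 1))) hm.restrict ?_
    filter_upwards [ae_restrict_of_ae ae_norm_pos, ae_restrict_of_ae hC, ae_restrict_mem hms]
      with x hx hxC hxI
    rw [hn x hx, norm_mul, Real.norm_of_nonneg (hK.2.1 _ hx).le, Real.norm_eq_abs]
    have h3 := (hK.2.1 _ hx).le
    have h4 : minPow q₁ q₂ (w x) ≤ C ^ (q₁ - 1) :=
      (min_le_left _ _).trans (Real.rpow_le_rpow (abs_nonneg _) (hxC hxI) (by linarith))
    calc K ‖x‖ * minPow q₁ q₂ (w x) * |h x| ≤ K ‖x‖ * C ^ (q₁ - 1) * |h x| := by gcongr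
      _ = _ := by ring
  have huniv : Metric.ball (0 : E N) R₁ ∪ (Metric.ball (0 : E N) R₂)ᶜ ∪
      {x : E N | ‖x‖ ∈ Icc R₁ (R₁ + R₂)} = univ := by
    refine eq_univ_of_forall fun x => ?_
    simp only [mem_union, mem_ball_zero_iff, mem_compl_iff, mem_ofPred_eq, mem_Icc, not_lt]
    by_cases h3 : ‖x‖ < R₁
    · exact Or.inl (Or.inl h3)
    by_cases h4 : R₂ ≤ ‖x‖
    · exact Or.inl (Or.inr h4)
    · exact Or.inr ⟨not_lt.1 h3, by linarith⟩
  rw [← integrableOn_univ, ← huniv]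
  exact (i1.union i2).union i3

end PLap

end

/-! ### Differentiating the energy along radial directions. -/

noncomputable section

namespace PLap

variable {N : ℕ} {p : ℝ} {V : ℝ → ℝ≥0∞} {q₁ q₂ : ℝ} {g : ℝ → ℝ → ℝ}

/-- For simple v the composition is a finite sum of measurable sections of g; continuity in the
second variable passes to the limit. -/
theorem IsCaratheodory.aestronglyMeasurable_comp {X : Type*} [MeasurableSpace X] {μ : Measure X}
    (hg : IsCaratheodory g) {ρ : X → ℝ}
    (hρ : Measure.QuasiMeasurePreserving ρ μ (volume.restrict (Ioi (0 : ℝ)))) {v : X → ℝ}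
    (hv : AEMeasurable v μ) : AEStronglyMeasurable (fun x => g (ρ x) (v x)) μ := by
  obtain ⟨v', hv', hvv'⟩ := hv
  have hs := hv'.stronglyMeasurable
  refine aestronglyMeasurable_of_tendsto_ae Filter.atTop
    (f := fun n x => g (ρ x) (hs.approx n x)) (fun n => ?_) ?_
  · have e : (fun x => g (ρ x) (hs.approx n x)) = ∑ y ∈ (hs.approx n).range,
        ((hs.approx n) ⁻¹' {y}).indicator fun x => g (ρ x) y := by
      ext x
      rw [Finset.sum_apply, Finset.sum_eq_single (hs.approx n x)]
      · rw [indicator_of_mem (by simp)]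
      · intro y _ hy
        exact indicator_of_notMem (fun h => hy (by simpa using h.symm)) _
      · intro h
        exact absurd (SimpleFunc.mem_range_self _ x) h
    rw [e]
    refine Finset.aestronglyMeasurable_sum _ fun y _ => ?_
    exact (((hg.1 y).comp_quasiMeasurePreserving hρ).aestronglyMeasurable).indicator
      (SimpleFunc.measurableSet_fiber _ _)
  · filter_upwards [hvv', hρ.ae hg.2] with x hx hc
    rw [hx]
    exact (hc.tendsto _).comp (hs.tendsto_approx x)

theorem IsCaratheodory.aestronglyMeasurable_primitive [Nontrivial (E N)] (hg : IsCaratheodory g)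
    {u : E N → ℝ} (hu : AEMeasurable u) :
    AEStronglyMeasurable fun x => ∫ t in (0 : ℝ)..(u x), g ‖x‖ t := by
  -- The substitution t = τ u(x) fixes the interval of integration, so joint measurability on a
  -- product space applies.
  have e : (fun x => ∫ t in (0 : ℝ)..(u x), g ‖x‖ t) =
      fun x => u x * ∫ τ in Ioc (0 : ℝ) 1, g ‖x‖ (τ * u x) := by
    ext x
    rw [← intervalIntegral.integral_of_le zero_le_one, intervalIntegral.mul_integral_comp_mul_right]
    simp
  rw [e]
  refine hu.aestronglyMeasurable.mul ?_
  have h := hg.aestronglyMeasurable_comp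
    (μ := (volume : Measure (E N)).prod (volume.restrict (Ioc (0 : ℝ) 1)))
    (ρ := fun z => ‖z.1‖) (v := fun z => z.2 * u z.1)
    (quasiMeasurePreserving_norm.comp Measure.quasiMeasurePreserving_fst)
    (measurable_snd.aemeasurable.mul (hu.comp_quasiMeasurePreserving Measure.quasiMeasurePreserving_fst))
  exact h.integral_prod_right'

theorem minPow_mono (hq₁ : 1 < q₁) (hq₂ : 1 < q₂) {t a : ℝ} (h : |t| ≤ |a|) :
    minPow q₁ q₂ t ≤ minPow q₁ q₂ a :=
  min_le_min (Real.rpow_le_rpow (abs_nonneg _) h (by linarith))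
    (Real.rpow_le_rpow (abs_nonneg _) h (by linarith))

/-- The growth of `g` in the form used for the energy: `|g(|x|,t) - g(|x|,0)|` is controlled by
`k(x) min(|t|^(q₁-1), |t|^(q₂-1))`, and all the relevant integrals converge. -/
structure HasAdmissibleGrowth (N : ℕ) (p : ℝ) (V : ℝ → ℝ≥0∞) (g : ℝ → ℝ → ℝ) (q₁ q₂ : ℝ)
    (k : E N → ℝ) : Prop where
  caratheodory : IsCaratheodory g
  bound : ∀ᵐ x : E N, ∀ t, |g ‖x‖ t - g ‖x‖ 0| ≤ k x * minPow q₁ q₂ t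
  integrable : ∀ w h : E N → ℝ, MemWr p V w → MemW p V h →
    Integrable fun x => k x * (minPow q₁ q₂ (w x) * |h x|)
  integrable_zero : ∀ h : E N → ℝ, MemW p V h → Integrable fun x => g ‖x‖ 0 * h x

namespace HasAdmissibleGrowth

variable {k : E N → ℝ}

theorem ae_nonneg (H : HasAdmissibleGrowth N p V g q₁ q₂ k) : ∀ᵐ x, 0 ≤ k x := by
  filter_upwards [H.bound] with x hx
  have h := (abs_nonneg _).trans (hx 1)
  simpa [minPow] using h

theorem integrable_mul [Nontrivial (E N)] (H : HasAdmissibleGrowth N p V g q₁ q₂ k)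
    {w h : E N → ℝ} (hw : MemWr p V w) (hh : MemW p V h) :
    Integrable fun x => g ‖x‖ (w x) * h x := by
  refine ((H.integrable_zero h hh).norm.add (H.integrable w h hw hh)).mono'
    ((H.caratheodory.aestronglyMeasurable_comp quasiMeasurePreserving_norm hw.1.aemeasurable).mul
      hh.aemeasurable.aestronglyMeasurable) ?_
  filter_upwards [H.bound] with x hx
  simp only [Pi.add_apply, norm_mul, Real.norm_eq_abs]
  have h1 : |g ‖x‖ (w x)| ≤ |g ‖x‖ 0| + k x * minPow q₁ q₂ (w x) := by
    have h2 := abs_sub_abs_le_abs_sub (g ‖x‖ (w x)) (g ‖x‖ 0)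
    linarith [hx (w x)]
  calc |g ‖x‖ (w x)| * |h x| ≤ (|g ‖x‖ 0| + k x * minPow q₁ q₂ (w x)) * |h x| := by gcongr
    _ = _ := by ring

theorem integrable_primitive [Nontrivial (E N)] (hq₁ : 1 < q₁) (hq₂ : 1 < q₂)
    (H : HasAdmissibleGrowth N p V g q₁ q₂ k)
    {w : E N → ℝ} (hw : MemWr p V w) :
    Integrable fun x => ∫ t in (0 : ℝ)..(w x), g ‖x‖ t := by
  refine ((H.integrable_zero w hw.1).norm.add (H.integrable w w hw hw.1)).mono'
    (H.caratheodory.aestronglyMeasurable_primitive hw.1.aemeasurable) ?_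
  filter_upwards [H.bound, H.ae_nonneg] with x hx hk
  have h1 : ‖∫ t in (0 : ℝ)..(w x), g ‖x‖ t‖ ≤
      (|g ‖x‖ 0| + k x * minPow q₁ q₂ (w x)) * |w x - 0| := by
    refine intervalIntegral.norm_integral_le_of_norm_le_const fun t ht => ?_
    have h2 := abs_sub_abs_le_abs_sub (g ‖x‖ t) (g ‖x‖ 0)
    have h3 : |t| ≤ |w x| := by
      have := abs_sub_left_of_mem_uIcc (uIoc_subset_uIcc ht)
      simpa using this
    have h4 : k x * minPow q₁ q₂ t ≤ k x * minPow q₁ q₂ (w x) :=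
      mul_le_mul_of_nonneg_left (minPow_mono hq₁ hq₂ h3) hk
    rw [Real.norm_eq_abs]
    linarith [hx t]
  refine h1.trans (le_of_eq ?_)
  simp only [Pi.add_apply, norm_mul, Real.norm_eq_abs, sub_zero]
  ring

/-- For |t| < 1 the derivative g(|x|, u + tη)η is dominated independently of t, because `minPow` at
u + tη is bounded by a multiple of its values at u and η. -/
theorem hasDerivAt_integral_primitive [Nontrivial (E N)] (hp : 1 < p) (hq₁ : 1 < q₁) (hq₂ : 1 < q₂)
    (hV : AEMeasurable fun x : E N => V ‖x‖) (H : HasAdmissibleGrowth N p V g q₁ q₂ k)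
    {u η : E N → ℝ} (hu : MemWr p V u) (hη : MemWr p V η) :
    HasDerivAt (fun t : ℝ => ∫ x, ∫ τ in (0 : ℝ)..(u x + t * η x), g ‖x‖ τ)
      (∫ x, g ‖x‖ (u x) * η x) 0 := by
  have hmem : ∀ t : ℝ, MemWr p V fun x => u x + t * η x := fun t => hu.add hp hV (hη.const_mul hp t)
  have hb : Integrable fun x => ‖g ‖x‖ 0 * η x‖ + 2 ^ (q₁ + q₂) *
      (k x * (minPow q₁ q₂ (u x) * |η x|) + k x * (minPow q₁ q₂ (η x) * |η x|)) :=
    (H.integrable_zero η hη.1).norm.add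
      (((H.integrable u η hu hη.1).add (H.integrable η η hη hη.1)).const_mul _)
  have key := hasDerivAt_integral_of_dominated_loc_of_deriv_le (μ := (volume : Measure (E N)))
    (F := fun t x => ∫ τ in (0 : ℝ)..(u x + t * η x), g ‖x‖ τ)
    (F' := fun t x => g ‖x‖ (u x + t * η x) * η x) (x₀ := (0 : ℝ)) (s := Metric.ball 0 1)
    (Metric.ball_mem_nhds 0 one_pos)
    (Filter.Eventually.of_forall fun t =>
      H.caratheodory.aestronglyMeasurable_primitive (hmem t).1.aemeasurable)
    (H.integrable_primitive hq₁ hq₂ (hmem 0)) (H.integrable_mul (hmem 0) hη.1).1 ?_ hb ?_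
  · simpa using key.2
  · filter_upwards [H.bound, H.ae_nonneg] with x hx hk t ht
    have ht1 : |t| ≤ 1 := by
      have : |t| < 1 := by simpa using ht
      exact this.le
    have h1 : |u x + t * η x| ≤ |u x| + |η x| := by
      refine (abs_add_le _ _).trans ?_
      rw [abs_mul]
      nlinarith [abs_nonneg (η x)]
    have h2 := minPow_le_of_abs_le_add hq₁ hq₂ h1
    have h3 := abs_sub_abs_le_abs_sub (g ‖x‖ (u x + t * η x)) (g ‖x‖ 0)
    have h4 := hx (u x + t * η x)
    have h5 := mul_le_mul_of_nonneg_left h2 hk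
    rw [norm_mul, norm_mul, Real.norm_eq_abs, Real.norm_eq_abs, Real.norm_eq_abs]
    calc |g ‖x‖ (u x + t * η x)| * |η x| ≤ (|g ‖x‖ 0| + k x * (2 ^ (q₁ + q₂) *
          (minPow q₁ q₂ (u x) + minPow q₁ q₂ (η x)))) * |η x| := by
          gcongr
          linarith
      _ = _ := by ring
  · filter_upwards [quasiMeasurePreserving_norm.ae H.caratheodory.2] with x hc t _
    have h1 : HasDerivAt (fun y => ∫ τ in (0 : ℝ)..y, g ‖x‖ τ) (g ‖x‖ (u x + t * η x))
        (u x + t * η x) := (hc.integral_hasStrictDerivAt 0 _).hasDerivAt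
    have h2 : HasDerivAt (fun t : ℝ => u x + t * η x) (η x) t := by
      simpa using ((hasDerivAt_id t).mul_const (η x)).const_add (u x)
    exact h1.comp t h2

end HasAdmissibleGrowth

section norm

variable {H : Type*} [NormedAddCommGroup H] [InnerProductSpace ℝ H]

theorem hasDerivAt_norm_add_smul_rpow (hp : 1 < p) (a b : H) (t : ℝ) :
    HasDerivAt (fun t : ℝ => ‖a + t • b‖ ^ p)
      (p * (‖a + t • b‖ ^ (p - 2) * inner ℝ (a + t • b) b)) t := by
  have h1 : HasDerivAt (fun t : ℝ => a + t • b) b t := by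
    simpa using ((hasDerivAt_id t).smul_const b).const_add a
  have h2 := (hasFDerivAt_norm_rpow (a + t • b) hp).comp_hasDerivAt t h1
  refine h2.congr_deriv ?_
  rw [smul_apply, innerSL_apply_apply, smul_eq_mul, mul_assoc]

theorem abs_norm_rpow_mul_inner_le (hp : 1 < p) (a b : H) :
    |‖a‖ ^ (p - 2) * inner ℝ a b| ≤ ‖a‖ ^ p + ‖b‖ ^ p := by
  have hnn : 0 ≤ ‖a‖ ^ p + ‖b‖ ^ p := by positivity
  -- Treated apart because p - 2 may be negative; the inner product vanishes here.
  by_cases ha : a = 0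
  · simpa [ha] using hnn
  have hapos : 0 < ‖a‖ := norm_pos_iff.2 ha
  set m := max ‖a‖ ‖b‖ with hmd
  have hmpos : 0 < m := hapos.trans_le (le_max_left _ _)
  calc |‖a‖ ^ (p - 2) * inner ℝ a b| = ‖a‖ ^ (p - 2) * |inner ℝ a b| := by
        rw [abs_mul, abs_of_nonneg (by positivity)]
    _ ≤ ‖a‖ ^ (p - 2) * (‖a‖ * ‖b‖) := by
        gcongr
        exact abs_real_inner_le_norm _ _
    _ = ‖a‖ ^ (p - 1) * ‖b‖ := by
        rw [show p - 1 = (p - 2) + 1 by ring, Real.rpow_add_one hapos.ne']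
        ring
    _ ≤ m ^ (p - 1) * m := by
        have h1 : ‖a‖ ^ (p - 1) ≤ m ^ (p - 1) :=
          Real.rpow_le_rpow hapos.le (le_max_left _ _) (by linarith)
        exact mul_le_mul h1 (le_max_right _ _) (norm_nonneg _) (by positivity)
    _ = m ^ p := by
        rw [← Real.rpow_add_one hmpos.ne']
        congr 1
        ring
    _ ≤ ‖a‖ ^ p + ‖b‖ ^ p := by
        rcases max_choice ‖a‖ ‖b‖ with h | h <;> rw [hmd, h]
        · linarith [Real.rpow_nonneg (norm_nonneg b) p]
        · linarith [Real.rpow_nonneg (norm_nonneg a) p]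

theorem norm_add_smul_rpow_le (hp : 1 < p) (a b : H) {t : ℝ} (ht : |t| ≤ 1) :
    ‖a + t • b‖ ^ p ≤ 2 ^ p * (‖a‖ ^ p + ‖b‖ ^ p) := by
  have h1 : ‖a + t • b‖ ≤ 2 * max ‖a‖ ‖b‖ := by
    calc ‖a + t • b‖ ≤ ‖a‖ + |t| * ‖b‖ := by
          refine (norm_add_le _ _).trans ?_
          rw [norm_smul, Real.norm_eq_abs]
      _ ≤ ‖a‖ + 1 * ‖b‖ := by gcongr
      _ ≤ _ := by linarith [le_max_left ‖a‖ ‖b‖, le_max_right ‖a‖ ‖b‖]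
  refine (Real.rpow_le_rpow (norm_nonneg _) h1 (by linarith)).trans ?_
  rw [Real.mul_rpow (by norm_num) (le_max_of_le_left (norm_nonneg _))]
  gcongr
  rcases max_choice ‖a‖ ‖b‖ with h | h <;> rw [h]
  · linarith [Real.rpow_nonneg (norm_nonneg b) p]
  · linarith [Real.rpow_nonneg (norm_nonneg a) p]

/-- Differentiation of `∫ ‖a + t b‖^p` against a weight. -/
theorem hasDerivAt_integral_norm_rpow {X : Type*} [MeasurableSpace X] {μ : Measure X} (hp : 1 < p)
    {a b : X → H} {wt : X → ℝ} (hwt : AEStronglyMeasurable wt μ) (hwt0 : ∀ x, 0 ≤ wt x)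
    (ha : AEStronglyMeasurable a μ)
    (hb : AEStronglyMeasurable b μ) (hai : Integrable (fun x => wt x * ‖a x‖ ^ p) μ)
    (hbi : Integrable (fun x => wt x * ‖b x‖ ^ p) μ) :
    Integrable (fun x => wt x * (‖a x‖ ^ (p - 2) * inner ℝ (a x) (b x))) μ ∧
    HasDerivAt (fun t : ℝ => ∫ x, wt x * ‖a x + t • b x‖ ^ p ∂μ)
      (p * ∫ x, wt x * (‖a x‖ ^ (p - 2) * inner ℝ (a x) (b x)) ∂μ) 0 := by
  have hm : AEStronglyMeasurable (fun x => wt x * (‖a x‖ ^ (p - 2) * inner ℝ (a x) (b x))) μ :=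
    hwt.mul ((ha.norm.aemeasurable.pow_const _).aestronglyMeasurable.mul (ha.inner hb))
  have hi : Integrable (fun x => wt x * (‖a x‖ ^ (p - 2) * inner ℝ (a x) (b x))) μ := by
    refine (hai.add hbi).mono' hm (ae_of_all _ fun x => ?_)
    rw [norm_mul, Real.norm_of_nonneg (hwt0 x), Real.norm_eq_abs, Pi.add_apply, ← mul_add]
    exact mul_le_mul_of_nonneg_left (abs_norm_rpow_mul_inner_le hp _ _) (hwt0 x)
  refine ⟨hi, ?_⟩
  have key := hasDerivAt_integral_of_dominated_loc_of_deriv_le (μ := μ)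
    (F := fun t x => wt x * ‖a x + t • b x‖ ^ p)
    (F' := fun t x => wt x * (p * (‖a x + t • b x‖ ^ (p - 2) * inner ℝ (a x + t • b x) (b x))))
    (bound := fun x => p * (2 ^ p * (wt x * ‖a x‖ ^ p + wt x * ‖b x‖ ^ p) + wt x * ‖b x‖ ^ p))
    (x₀ := (0 : ℝ)) (s := Metric.ball 0 1) (Metric.ball_mem_nhds 0 one_pos)
    (Filter.Eventually.of_forall fun t =>
      hwt.mul ((ha.add (hb.const_smul t)).norm.aemeasurable.pow_const _).aestronglyMeasurable)
    (by simpa using hai) ?_ ?_ ((((hai.add hbi).const_mul _).add hbi).const_mul _) ?_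
  · refine key.2.congr_deriv ?_
    rw [← integral_const_mul]
    congr 1
    ext x
    simp
    ring
  · refine (hm.const_mul p).congr (ae_of_all _ fun x => ?_)
    simp
    ring
  · refine ae_of_all _ fun x t ht => ?_
    have ht1 : |t| ≤ 1 := by
      have : |t| < 1 := by simpa using ht
      exact this.le
    rw [norm_mul, Real.norm_of_nonneg (hwt0 x), norm_mul, Real.norm_of_nonneg (by linarith : 0 ≤ p),
      Real.norm_eq_abs]
    have h1 := abs_norm_rpow_mul_inner_le hp (a x + t • b x) (b x)
    have h2 := norm_add_smul_rpow_le hp (a x) (b x) ht1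
    calc wt x * (p * |‖a x + t • b x‖ ^ (p - 2) * inner ℝ (a x + t • b x) (b x)|)
        ≤ wt x * (p * (2 ^ p * (‖a x‖ ^ p + ‖b x‖ ^ p) + ‖b x‖ ^ p)) := by
          refine mul_le_mul_of_nonneg_left ?_ (hwt0 x)
          refine mul_le_mul_of_nonneg_left ?_ (by linarith)
          linarith
      _ = _ := by ring
  · refine ae_of_all _ fun x t _ => ?_
    exact (hasDerivAt_norm_add_smul_rpow hp (a x) (b x) t).const_mul (wt x)

end norm

theorem norm_rpow_mul_inner (a b : ℝ) : ‖a‖ ^ (p - 2) * inner ℝ a b = |a| ^ (p - 2) * a * b := by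
  rw [Real.norm_eq_abs, mul_assoc]
  simp [mul_comm b]

theorem MemW.integrable_grad_inner (hp : 1 < p) {u h : E N → ℝ} (hu : MemW p V u)
    (hh : MemW p V h) : Integrable fun x =>
      ‖weakGradient u x‖ ^ (p - 2) * inner ℝ (weakGradient u x) (weakGradient h x) := by
  have := (hasDerivAt_integral_norm_rpow hp (wt := fun _ => 1) aestronglyMeasurable_const
    (fun _ => zero_le_one) hu.1.2.2.1 hh.1.2.2.1 (by simpa using hu.integrable_grad hp)
    (by simpa using hh.integrable_grad hp)).1
  simpa using this

theorem MemW.integrable_potential_mul (hp : 1 < p) (hV : AEMeasurable fun x : E N => V ‖x‖)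
    {u h : E N → ℝ} (hu : MemW p V u) (hh : MemW p V h) :
    Integrable fun x => (V ‖x‖).toReal * (|u x| ^ (p - 2) * u x * h x) := by
  have := (hasDerivAt_integral_norm_rpow hp (wt := fun x => (V ‖x‖).toReal)
    hV.ennreal_toReal.aestronglyMeasurable (fun _ => ENNReal.toReal_nonneg)
    hu.aemeasurable.aestronglyMeasurable hh.aemeasurable.aestronglyMeasurable
    (hu.integrable_potential hV) (hh.integrable_potential hV)).1
  simpa only [norm_rpow_mul_inner] using this

/-- The derivative of `‖u‖^p` in the direction `η`. -/
theorem MemW.hasDerivAt_wNorm_rpow (hp : 1 < p) (hV : AEMeasurable fun x : E N => V ‖x‖)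
    {u η : E N → ℝ} (hu : MemW p V u) (hη : MemW p V η) :
    HasDerivAt (fun t : ℝ => wNorm p V (u + fun x => t * η x) ^ p)
      (p * ((∫ x, ‖weakGradient u x‖ ^ (p - 2) * inner ℝ (weakGradient u x) (weakGradient η x)) +
        ∫ x, (V ‖x‖).toReal * (|u x| ^ (p - 2) * u x * η x))) 0 := by
  have h1 := (hasDerivAt_integral_norm_rpow hp (wt := fun _ => 1) aestronglyMeasurable_const
    (fun _ => zero_le_one) hu.1.2.2.1 hη.1.2.2.1 (by simpa using hu.integrable_grad hp)
    (by simpa using hη.integrable_grad hp)).2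
  have h2 := (hasDerivAt_integral_norm_rpow hp (wt := fun x => (V ‖x‖).toReal)
    hV.ennreal_toReal.aestronglyMeasurable (fun _ => ENNReal.toReal_nonneg)
    hu.aemeasurable.aestronglyMeasurable hη.aemeasurable.aestronglyMeasurable
    (hu.integrable_potential hV) (hη.integrable_potential hV)).2
  have e : (fun t : ℝ => wNorm p V (u + fun x => t * η x) ^ p) =
      (fun t : ℝ => ∫ x, 1 * ‖weakGradient u x + t • weakGradient η x‖ ^ p) +
        fun t : ℝ => ∫ x, (V ‖x‖).toReal * ‖u x + t • η x‖ ^ p := by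
    ext t
    have hm := hu.add hp hV (hη.const_mul hp t)
    rw [hm.wNorm_rpow hp hV, integral_add (hm.integrable_grad hp) (hm.integrable_potential hV)]
    simp only [Pi.add_apply, one_mul]
    refine congrArg₂ (· + ·) (integral_congr_ae ?_) rfl
    filter_upwards [weakGradient_add hu.1.2.1 (hη.const_mul hp t).1.2.1,
      weakGradient_const_mul hη.1.2.1 t] with x hx hx2
    rw [hx, Pi.add_apply, hx2]
  rw [e]
  refine (h1.add h2).congr_deriv ?_
  rw [mul_add]
  congr 2
  · simp
  · simp only [norm_rpow_mul_inner]

/-- The derivative of the energy functional vanishes in radial directions at a critical point. -/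
theorem IsCriticalPoint.weak_equation_of_radial [Nontrivial (E N)] (hp : 1 < p)
    (hq₁ : 1 < q₁) (hq₂ : 1 < q₂) (hV : AEMeasurable fun x : E N => V ‖x‖) {k : E N → ℝ}
    (H : HasAdmissibleGrowth N p V g q₁ q₂ k) {u η : E N → ℝ} (hu : IsCriticalPoint p V g u)
    (hη : MemWr p V η) :
    (∫ x, ‖weakGradient u x‖ ^ (p - 2) * inner ℝ (weakGradient u x) (weakGradient η x)) +
        ∫ x, (V ‖x‖).toReal * (|u x| ^ (p - 2) * u x * η x) = ∫ x, g ‖x‖ (u x) * η x := by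
  set A := (∫ x, ‖weakGradient u x‖ ^ (p - 2) * inner ℝ (weakGradient u x) (weakGradient η x)) +
        ∫ x, (V ‖x‖).toReal * (|u x| ^ (p - 2) * u x * η x) with hA
  have hd : HasDerivAt (fun t : ℝ => functionalI p V g (u + fun x => t * η x))
      (A - ∫ x, g ‖x‖ (u x) * η x) 0 := by
    have h1 := (hu.1.1.hasDerivAt_wNorm_rpow hp hV hη.1).const_mul (1 / p)
    have h2 := H.hasDerivAt_integral_primitive hp hq₁ hq₂ hV hu.1 hη
    refine (h1.sub h2).congr_deriv ?_
    rw [← hA, ← mul_assoc, one_div_mul_cancel (by linarith), one_mul]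
  -- Along the increments tη, the o(‖h‖) condition bounds the directional derivative by ε‖η‖ for
  -- every ε > 0.
  have hle : ∀ ε : ℝ, 0 < ε → ‖A - ∫ x, g ‖x‖ (u x) * η x‖ ≤ ε * wNorm p V η := by
    intro ε hε
    obtain ⟨δ, hδ, hI⟩ := hu.2 ε hε
    refine hd.le_of_lip' (mul_nonneg hε.le (wNorm_nonneg η)) ?_
    have hcont : Filter.Tendsto (fun t : ℝ => |t| * wNorm p V η) (nhds 0) (nhds 0) := by
      have : Continuous fun t : ℝ => |t| * wNorm p V η := by fun_prop
      simpa using this.tendsto 0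
    filter_upwards [hcont.eventually (gt_mem_nhds hδ)] with t ht
    have h1 := hI (fun x => t * η x) (hη.const_mul hp t) (by rwa [hη.1.wNorm_const_mul hp])
    rw [hη.1.wNorm_const_mul hp] at h1
    have e0 : (u + fun x => (0 : ℝ) * η x) = u := by ext x; simp
    rw [e0, Real.norm_eq_abs, sub_zero, Real.norm_eq_abs]
    linarith
  have h0 : ‖A - ∫ x, g ‖x‖ (u x) * η x‖ ≤ 0 := by
    have hlim : Filter.Tendsto (fun ε : ℝ => ε * wNorm p V η) (nhdsWithin 0 (Ioi 0)) (nhds 0) := by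
      have : Continuous fun ε : ℝ => ε * wNorm p V η := by fun_prop
      simpa using (this.tendsto 0).mono_left nhdsWithin_le_nhds
    exact ge_of_tendsto hlim (by filter_upwards [self_mem_nhdsWithin] with ε hε using hle ε hε)
  exact sub_eq_zero.1 (norm_le_zero_iff.1 h0)

end PLap

end

/-! ### Averaging over the orthogonal group. -/

noncomputable section

namespace PLap

variable {N : ℕ} {p : ℝ} {V : ℝ → ℝ≥0∞}

/-- The orthogonal group of `ℝ^N`. -/
abbrev O (N : ℕ) : Type := unitary (E N →L[ℝ] E N)

/-- Inversion in the unitary group is the adjoint, so its continuity underlies the topological group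
structure of `O N`. -/
instance instContinuousStar : ContinuousStar (E N →L[ℝ] E N) :=
  ⟨ContinuousLinearMap.adjoint.continuous⟩

/-- The isometry of `ℝ^N` given by an element of the orthogonal group. -/
def rot (R : O N) : E N ≃ₗᵢ[ℝ] E N := Unitary.linearIsometryEquiv R

theorem rot_symm_apply (R : O N) (x : E N) : (rot R).symm x = rot R⁻¹ x := rfl

theorem rot_mul (R S : O N) (x : E N) : rot (R * S) x = rot R (rot S x) := rfl

/-- The reflection in the hyperplane orthogonal to x - y exchanges vectors x and y of equal length.
-/
theorem exists_rot_eq {x y : E N} (h : ‖x‖ = ‖y‖) : ∃ S : O N, rot S x = y := by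
  refine ⟨Unitary.linearIsometryEquiv.symm (ℝ ∙ (x - y))ᗮ.reflection, ?_⟩
  rw [rot, MulEquiv.apply_symm_apply]
  exact Submodule.reflection_sub h

instance instCompactSpaceO : CompactSpace (O N) := by
  refine isCompact_iff_compactSpace.1 ?_
  have : ProperSpace (E N →L[ℝ] E N) := FiniteDimensional.proper ℝ _
  refine Metric.isCompact_of_isClosed_isBounded isClosed_unitary ?_
  refine (Metric.isBounded_closedBall (x := (0 : E N →L[ℝ] E N)) (r := 1)).subset fun R hR => ?_
  rw [mem_closedBall_zero_iff]
  refine ContinuousLinearMap.opNorm_le_bound _ zero_le_one fun x => ?_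
  rw [one_mul]
  exact ((rot ⟨R, hR⟩).norm_map x).le

/-- The normalized Haar measure of the orthogonal group. -/
def haarO (N : ℕ) : Measure (O N) := Measure.haarMeasure ⊤

instance instIsProbabilityMeasureHaarO : IsProbabilityMeasure (haarO N) :=
  ⟨by simpa [haarO] using Measure.haarMeasure_self (K₀ := (⊤ : TopologicalSpace.PositiveCompacts (O N)))⟩

instance instIsMulLeftInvariantHaarO : (haarO N).IsMulLeftInvariant := by
  unfold haarO
  infer_instance

theorem continuous_rot : Continuous fun z : E N × O N => rot z.2 z.1 :=
  (continuous_subtype_val.comp continuous_snd).clm_apply continuous_fst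

theorem continuous_rot_symm : Continuous fun z : E N × O N => (rot z.2).symm z.1 :=
  continuous_rot.comp (continuous_fst.prodMk (continuous_inv.comp continuous_snd))

theorem measurableEmbedding_rot (R : O N) : MeasurableEmbedding (rot R) :=
  (rot R).toHomeomorph.measurableEmbedding

/-- Every rotation preserves Lebesgue measure, so null sets pull back to null sets slice by slice.
Hence h(R⁻¹x) is a.e. measurable on the product even if h is only a.e. measurable. -/
theorem quasiMeasurePreserving_rot_symm : Measure.QuasiMeasurePreserving
    (fun z : E N × O N => (rot z.2).symm z.1) (volume.prod (haarO N)) volume :=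
  QuasiMeasurePreserving.prod_of_left continuous_rot_symm.measurable
    (ae_of_all _ fun R => (rot R).symm.measurePreserving.quasiMeasurePreserving)

/-- Fubini for functions on `ℝ^N × O(N)` which are constant along the orbits of `O(N)`. -/
theorem integral_prod_of_rot_invariant {k : E N × O N → ℝ}
    (hk : AEStronglyMeasurable k (volume.prod (haarO N))) {k₀ : E N → ℝ} (hk₀ : Integrable k₀)
    (h : ∀ R, ∀ᵐ y, k (rot R y, R) = k₀ y) :
    Integrable k (volume.prod (haarO N)) ∧ ∫ x, ∫ R, k (x, R) ∂(haarO N) = ∫ y, k₀ y := by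
  have hnorm : ∀ R, ∫ x, ‖k (x, R)‖ = ∫ y, ‖k₀ y‖ := fun R => by
    rw [← (rot R).measurePreserving.integral_comp (measurableEmbedding_rot R)]
    refine integral_congr_ae ?_
    filter_upwards [h R] with y hy
    rw [hy]
  have hi : Integrable k (volume.prod (haarO N)) := by
    rw [integrable_prod_iff' hk]
    refine ⟨ae_of_all _ fun R => ?_, ?_⟩
    · rw [← (rot R).measurePreserving.integrable_comp_emb (measurableEmbedding_rot R)]
      exact hk₀.congr (by filter_upwards [h R] with y hy; exact hy.symm)
    · simp only [hnorm]
      exact integrable_const _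
  refine ⟨hi, ?_⟩
  rw [← integral_prod k hi, integral_prod_symm k hi]
  have : ∀ R, ∫ x, k (x, R) = ∫ y, k₀ y := fun R => by
    rw [← (rot R).measurePreserving.integral_comp (measurableEmbedding_rot R)]
    exact integral_congr_ae (h R)
  simp [this]

section average

variable {H : Type*} [NormedAddCommGroup H] [NormedSpace ℝ H]

/-- Jensen's inequality for averages over `O(N)`. -/
theorem lintegral_average_le {q : ℝ} (hq : 1 ≤ q) {F : E N × O N → H}
    (hF : AEStronglyMeasurable F (volume.prod (haarO N))) {f₀ : E N → H}
    (h : ∀ R y, ‖F (rot R y, R)‖ = ‖f₀ y‖) {W : E N → ℝ≥0∞} (hW : AEMeasurable W)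
    (hWr : ∀ R y, W (rot R y) = W y) :
    ∫⁻ x, W x * ‖∫ R, F (x, R) ∂(haarO N)‖ₑ ^ q ≤ ∫⁻ y, W y * ‖f₀ y‖ₑ ^ q := by
  have hq0 : 0 < q := by linarith
  have hm : AEMeasurable (fun z : E N × O N => W z.1 * ‖F z‖ₑ ^ q) (volume.prod (haarO N)) :=
    (hW.comp_quasiMeasurePreserving Measure.quasiMeasurePreserving_fst).mul (hF.enorm.pow_const q)
  calc ∫⁻ x, W x * ‖∫ R, F (x, R) ∂(haarO N)‖ₑ ^ q
      ≤ ∫⁻ x, ∫⁻ R, W x * ‖F (x, R)‖ₑ ^ q ∂(haarO N) := by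
        refine lintegral_mono_ae ?_
        filter_upwards [hF.prodMk_left] with x hx
        rw [lintegral_const_mul'' _ (hx.enorm.pow_const q)]
        gcongr
        -- On a probability space the L¹ norm is at most the L^q norm; this is the Jensen step.
        have h1 := eLpNorm'_le_eLpNorm'_of_exponent_le one_pos hq (haarO N) hx
        simp only [eLpNorm', ENNReal.rpow_one, div_one] at h1
        rw [one_div, ENNReal.le_rpow_inv_iff hq0] at h1
        exact (ENNReal.rpow_le_rpow (enorm_integral_le_lintegral_enorm _) hq0.le).trans h1
    _ = ∫⁻ R, ∫⁻ x, W x * ‖F (x, R)‖ₑ ^ q ∂volume ∂(haarO N) := lintegral_lintegral_swap hm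
    _ = ∫⁻ _, ∫⁻ y, W y * ‖f₀ y‖ₑ ^ q ∂volume ∂(haarO N) := by
        refine lintegral_congr fun R => ?_
        rw [← (rot R).measurePreserving.lintegral_comp_emb (measurableEmbedding_rot R)]
        refine lintegral_congr fun y => ?_
        rw [hWr, ← ofReal_norm, h, ofReal_norm]
    _ = _ := by simp

theorem memLp_average {q : ℝ} (hq : 1 ≤ q) {F : E N × O N → H}
    (hF : AEStronglyMeasurable F (volume.prod (haarO N))) {f₀ : E N → H}
    (hf₀ : MemLp f₀ (ENNReal.ofReal q)) (h : ∀ R y, ‖F (rot R y, R)‖ = ‖f₀ y‖) :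
    MemLp (fun x => ∫ R, F (x, R) ∂(haarO N)) (ENNReal.ofReal q) := by
  have hq0 : ENNReal.ofReal q ≠ 0 := (ENNReal.ofReal_pos.2 (by linarith)).ne'
  have hqr : (ENNReal.ofReal q).toReal = q := ENNReal.toReal_ofReal (by linarith)
  refine ⟨hF.integral_prod_right', ?_⟩
  rw [eLpNorm_lt_top_iff_lintegral_rpow_enorm_lt_top hq0 ENNReal.ofReal_ne_top, hqr]
  have h1 := lintegral_rpow_enorm_lt_top_of_eLpNorm_lt_top hq0 ENNReal.ofReal_ne_top hf₀.2
  rw [hqr] at h1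
  have h2 := lintegral_average_le hq hF h (W := fun _ => 1) aemeasurable_const fun _ _ => rfl
  simp only [one_mul] at h2
  exact h2.trans_lt h1

/-- The cutoff ψ is dominated by the rotation-invariant function C·1_B with B a centred ball, which
reduces the claim to integrability of f₀ on B. -/
theorem integrable_prod_smul {F : E N × O N → H}
    (hF : AEStronglyMeasurable F (volume.prod (haarO N))) {f₀ : E N → H}
    (hf₀ : LocallyIntegrable f₀) (h : ∀ R y, ‖F (rot R y, R)‖ = ‖f₀ y‖) {ψ : E N → ℝ}
    (hψ : AEStronglyMeasurable ψ) {ρ C : ℝ} (hC : ∀ x, |ψ x| ≤ C)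
    (hs : ∀ x ∉ Metric.closedBall (0 : E N) ρ, ψ x = 0) :
    Integrable (fun z : E N × O N => ψ z.1 • F z) (volume.prod (haarO N)) := by
  have hms : MeasurableSet (Metric.closedBall (0 : E N) ρ) := Metric.isClosed_closedBall.measurableSet
  let c : E N → ℝ := (Metric.closedBall (0 : E N) ρ).indicator fun _ => C
  have hcr : ∀ R y, c (rot R y) = c y := by
    intro R y
    by_cases hy : y ∈ Metric.closedBall (0 : E N) ρ
    · have hy' : rot R y ∈ Metric.closedBall (0 : E N) ρ := by simpa using hy
      simp only [c]
      rw [indicator_of_mem hy, indicator_of_mem hy']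
    · have hy' : rot R y ∉ Metric.closedBall (0 : E N) ρ := by simpa using hy
      simp only [c]
      rw [indicator_of_notMem hy, indicator_of_notMem hy']
  have hi : Integrable fun y => c y * ‖f₀ y‖ := by
    have h1 := ((hf₀.integrableOn_isCompact (isCompact_closedBall (0 : E N) ρ)).norm.const_mul C)
    refine ((integrable_indicator_iff hms).2 h1).congr (ae_of_all _ fun y => ?_)
    by_cases hy : y ∈ Metric.closedBall (0 : E N) ρ
    · simp only [c]
      rw [indicator_of_mem hy, indicator_of_mem hy]
    · simp only [c]
      rw [indicator_of_notMem hy, indicator_of_notMem hy, zero_mul]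
  have hcm : Measurable c := measurable_const.indicator hms
  have hk := (integral_prod_of_rot_invariant (k := fun z => c z.1 * ‖F z‖)
    ((hcm.comp measurable_fst).aestronglyMeasurable.mul hF.norm) hi
    fun R => ae_of_all _ fun y => by simp only [hcr, h]).1
  refine hk.mono' ((hψ.comp_quasiMeasurePreserving Measure.quasiMeasurePreserving_fst).smul hF)
    (ae_of_all _ fun z => ?_)
  rw [norm_smul, Real.norm_eq_abs]
  refine mul_le_mul_of_nonneg_right ?_ (norm_nonneg _)
  by_cases hz : z.1 ∈ Metric.closedBall (0 : E N) ρ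
  · simp only [c]
    rw [indicator_of_mem hz]
    exact hC _
  · simp only [c]
    rw [indicator_of_notMem hz, hs _ hz, abs_zero]

/-- Orbits stay in centred balls, so local integrability suffices, by exhausting ℝ^N with balls of
integer radius. -/
theorem ae_integrable_fiber {F : E N × O N → H}
    (hF : AEStronglyMeasurable F (volume.prod (haarO N))) {f₀ : E N → H}
    (hf₀ : LocallyIntegrable f₀) (h : ∀ R y, ‖F (rot R y, R)‖ = ‖f₀ y‖) :
    ∀ᵐ x, Integrable (fun R => F (x, R)) (haarO N) := by
  have h1 : ∀ n : ℕ, ∀ᵐ x : E N, x ∈ Metric.closedBall (0 : E N) n →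
      Integrable (fun R => F (x, R)) (haarO N) := by
    intro n
    have h2 := integrable_prod_smul hF hf₀ h (ρ := n) (C := 1)
      (ψ := (Metric.closedBall (0 : E N) n).indicator fun _ => 1)
      (measurable_const.indicator Metric.isClosed_closedBall.measurableSet).aestronglyMeasurable
      (fun x => by
        by_cases hx : x ∈ Metric.closedBall (0 : E N) n
        · rw [indicator_of_mem hx, abs_one]
        · rw [indicator_of_notMem hx, abs_zero]; exact zero_le_one)
      (fun x hx => indicator_of_notMem hx _)
    filter_upwards [h2.prod_right_ae] with x hx hxn
    simpa [indicator_of_mem hxn] using hx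
  filter_upwards [ae_all_iff.2 h1] with x hx
  obtain ⟨n, hn⟩ := exists_nat_ge ‖x‖
  exact hx n (by simpa using hn)

end average

/-- The functions `h ∘ R⁻¹`, as a function on `ℝ^N × O(N)`. -/
def orbit (h : E N → ℝ) (z : E N × O N) : ℝ := h ((rot z.2).symm z.1)

/-- The gradients `R ∇h(R⁻¹ x)` of the functions `h ∘ R⁻¹`. -/
def orbitGradient (G : E N → E N) (z : E N × O N) : E N := rot z.2 (G ((rot z.2).symm z.1))

/-- The average of a function over the orbits of the orthogonal group. -/
def radialAverage (h : E N → ℝ) (x : E N) : ℝ := ∫ R, orbit h (x, R) ∂(haarO N)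

theorem aestronglyMeasurable_orbit {h : E N → ℝ} (hh : AEStronglyMeasurable h) :
    AEStronglyMeasurable (orbit h) (volume.prod (haarO N)) :=
  hh.comp_quasiMeasurePreserving quasiMeasurePreserving_rot_symm

theorem aestronglyMeasurable_orbitGradient {G : E N → E N} (hG : AEStronglyMeasurable G) :
    AEStronglyMeasurable (orbitGradient G) (volume.prod (haarO N)) := by
  have h1 := hG.comp_quasiMeasurePreserving quasiMeasurePreserving_rot_symm
  have h2 : AEStronglyMeasurable (fun z : E N × O N => z.2) (volume.prod (haarO N)) :=
    continuous_snd.aestronglyMeasurable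
  exact continuous_rot.comp_aestronglyMeasurable (h1.prodMk h2)

theorem orbit_rot (h : E N → ℝ) (R : O N) (y : E N) : orbit h (rot R y, R) = h y := by
  simp [orbit]

theorem orbitGradient_rot (G : E N → E N) (R : O N) (y : E N) :
    orbitGradient G (rot R y, R) = rot R (G y) := by
  simp [orbitGradient]

/-- Rotating x by S amounts to translating the integration variable by S⁻¹, which Haar measure does
not see. -/
theorem radialAverage_rot (h : E N → ℝ) (S : O N) (x : E N) :
    radialAverage h (rot S x) = radialAverage h x := by
  have e : ∀ R : O N, orbit h (rot S x, R) = orbit h (x, S⁻¹ * R) := by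
    intro R
    simp only [orbit, rot_symm_apply, mul_inv_rev, inv_inv, rot_mul]
  simp only [radialAverage, e]
  exact integral_mul_left_eq_self (fun R => orbit h (x, R)) S⁻¹

theorem isRadial_radialAverage [Nontrivial (E N)] (h : E N → ℝ) : IsRadial (radialAverage h) := by
  obtain ⟨e, he⟩ := exists_norm_eq (E N) zero_le_one
  refine ⟨fun r => radialAverage h (r • e), ae_of_all _ fun x => ?_⟩
  obtain ⟨S, hS⟩ := exists_rot_eq (x := x) (y := ‖x‖ • e) (by simp [norm_smul, he])
  change radialAverage h x = radialAverage h (‖x‖ • e)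
  rw [← hS, radialAverage_rot]

/-- The weak gradient of the average is the average of the weak gradients. -/
theorem HasWeakGradient.radialAverage {h : E N → ℝ} {G : E N → E N} (hG : HasWeakGradient h G)
    (h1 : LocallyIntegrable (radialAverage h))
    (h2 : LocallyIntegrable fun x => ∫ R, orbitGradient G (x, R) ∂(haarO N)) :
    HasWeakGradient (PLap.radialAverage h) fun x => ∫ R, orbitGradient G (x, R) ∂(haarO N) := by
  refine ⟨h1, h2, fun φ hφ hc v => ?_⟩
  have hmh := aestronglyMeasurable_orbit hG.1.aestronglyMeasurable
  have hmG := aestronglyMeasurable_orbitGradient hG.2.1.aestronglyMeasurable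
  have hnh : ∀ (R : O N) y, ‖orbit h (rot R y, R)‖ = ‖h y‖ := fun R y => by rw [orbit_rot]
  have hnG : ∀ (R : O N) y, ‖orbitGradient G (rot R y, R)‖ = ‖G y‖ := fun R y => by
    rw [orbitGradient_rot, LinearIsometryEquiv.norm_map]
  have bdd : ∀ ψ : E N → ℝ, Continuous ψ → HasCompactSupport ψ →
      ∃ C ρ : ℝ, (∀ x, |ψ x| ≤ C) ∧ ∀ x ∉ Metric.closedBall (0 : E N) ρ, ψ x = 0 := by
    intro ψ hψ hs
    obtain ⟨C, hC⟩ := hψ.bounded_above_of_compact_support hs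
    obtain ⟨ρ, hρ⟩ := hs.isCompact.isBounded.subset_closedBall (0 : E N)
    exact ⟨C, ρ, hC, fun x hx => image_eq_zero_of_notMem_tsupport fun hxs => hx (hρ hxs)⟩
  have hcd : Continuous fun x => fderiv ℝ φ x v :=
    (hφ.continuous_fderiv (by simp)).clm_apply continuous_const
  obtain ⟨C₁, ρ₁, hC₁, hρ₁⟩ := bdd _ hcd (hc.fderiv_apply (𝕜 := ℝ) v)
  obtain ⟨C₂, ρ₂, hC₂, hρ₂⟩ := bdd φ hφ.continuous hc
  have i1 := integrable_prod_smul hmh hG.1 hnh hcd.aestronglyMeasurable hC₁ hρ₁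
  have i2 := integrable_prod_smul hmG hG.2.1 hnG hφ.continuous.aestronglyMeasurable hC₂ hρ₂
  have i2' := i2.inner_const (𝕜 := ℝ) v
  have e1 : ∫ x, PLap.radialAverage h x * fderiv ℝ φ x v =
      ∫ x, ∫ R, fderiv ℝ φ x v • orbit h (x, R) ∂(haarO N) := by
    refine integral_congr_ae (ae_of_all _ fun x => ?_)
    simp only [smul_eq_mul, integral_const_mul, PLap.radialAverage]
    rw [mul_comm]
  have e2 : ∫ x, inner ℝ (∫ R, orbitGradient G (x, R) ∂(haarO N)) v * φ x =
      ∫ x, ∫ R, inner ℝ (φ x • orbitGradient G (x, R)) v ∂(haarO N) := by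
    refine integral_congr_ae ?_
    filter_upwards [ae_integrable_fiber hmG hG.2.1 hnG] with x hx
    simp only [inner_smul_left, conj_trivial, integral_const_mul]
    rw [real_inner_comm, ← integral_inner hx, mul_comm]
    simp only [real_inner_comm]
  rw [e1, e2, ← integral_prod _ i1, ← integral_prod _ i2', integral_prod_symm _ i1,
    integral_prod_symm _ i2', ← integral_neg]
  -- After Fubini, R is fixed and the claim is the weak gradient identity for h ∘ R⁻¹.
  refine integral_congr_ae (ae_of_all _ fun R => ?_)
  have := (hG.comp_linearIsometryEquiv (rot R)).2.2 φ hφ hc v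
  simp only [inner_smul_left, conj_trivial, smul_eq_mul, orbit, orbitGradient]
  simp only [mul_comm] at this ⊢
  exact this

theorem MemW.hasWeakGradient_radialAverage (hp : 1 < p) (hpN : p < N) {h : E N → ℝ}
    (hh : MemW p V h) : HasWeakGradient (radialAverage h)
      fun x => ∫ R, orbitGradient (weakGradient h) (x, R) ∂(haarO N) := by
  have hG := hasWeakGradient_weakGradient hh.1.2.1
  refine hG.radialAverage ?_ ?_
  · refine (memLp_average (one_lt_sobolevExponent hp hpN).le
      (aestronglyMeasurable_orbit hh.1.1.1) hh.1.1 fun R y => by rw [orbit_rot]).locallyIntegrable ?_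
    exact ENNReal.one_le_ofReal.2 (one_lt_sobolevExponent hp hpN).le
  · refine (memLp_average hp.le (aestronglyMeasurable_orbitGradient hh.1.2.2.1) hh.1.2.2
      fun R y => by rw [orbitGradient_rot, LinearIsometryEquiv.norm_map]).locallyIntegrable ?_
    exact ENNReal.one_le_ofReal.2 hp.le

/-- Jensen is used for h with exponent p*, for the gradient with exponent p, and for h with exponent
p and the rotation-invariant weight V(|x|). -/
theorem MemW.memWr_radialAverage [Nontrivial (E N)] (hp : 1 < p) (hpN : p < N)
    (hV : AEMeasurable fun x : E N => V ‖x‖) {h : E N → ℝ} (hh : MemW p V h) :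
    MemWr p V (radialAverage h) := by
  have hw := hh.hasWeakGradient_radialAverage hp hpN
  refine ⟨⟨⟨?_, ⟨_, hw⟩, ?_⟩, ?_⟩, isRadial_radialAverage h⟩
  · exact memLp_average (one_lt_sobolevExponent hp hpN).le
      (aestronglyMeasurable_orbit hh.1.1.1) hh.1.1 fun R y => by rw [orbit_rot]
  · exact (memLp_average hp.le (aestronglyMeasurable_orbitGradient hh.1.2.2.1) hh.1.2.2
      fun R y => by rw [orbitGradient_rot, LinearIsometryEquiv.norm_map]).ae_eq
        hw.weakGradient_ae_eq.symm
  · exact (lintegral_average_le hp.le (aestronglyMeasurable_orbit hh.1.1.1)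
      (fun R y => by rw [orbit_rot]) hV fun R y => by rw [LinearIsometryEquiv.norm_map]).trans_lt hh.2

theorem ae_rot_eq_of_isRadial {u : E N → ℝ} (hu : IsRadial u) (R : O N) :
    ∀ᵐ y, u (rot R y) = u y := by
  obtain ⟨φ, hφ⟩ := hu
  filter_upwards [hφ, (rot R).measurePreserving.quasiMeasurePreserving.ae hφ] with y h1 h2
  rw [h1, h2, LinearIsometryEquiv.norm_map]

/-- Since u ∘ R⁻¹ = u a.e., both R ∇u(R⁻¹x) and ∇u are weak gradients of u, and uniqueness
identifies them. -/
theorem ae_weakGradient_rot {u : E N → ℝ} (hu : IsRadial u) (hG : ∃ G, HasWeakGradient u G)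
    (R : O N) : ∀ᵐ y, weakGradient u (rot R y) = rot R (weakGradient u y) := by
  have h1 := hasWeakGradient_weakGradient hG
  have h2 := h1.comp_linearIsometryEquiv (rot R)
  have h3 : (fun x => u ((rot R).symm x)) =ᵐ[volume] u := by
    have := (rot R).symm.measurePreserving.quasiMeasurePreserving.ae (ae_rot_eq_of_isRadial hu R)
    filter_upwards [this] with x hx
    rw [← hx, LinearIsometryEquiv.apply_symm_apply]
  have h4 := h1.ae_unique (h2.congr h3 (ae_eq_refl _))
  filter_upwards [(rot R).measurePreserving.quasiMeasurePreserving.ae h4] with y hy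
  rw [hy, LinearIsometryEquiv.symm_apply_apply]

/-- Averaging does not change integrals against rotation invariant functions. -/
theorem integral_mul_radialAverage {c h : E N → ℝ} (hc : AEStronglyMeasurable c)
    (hcr : ∀ R : O N, ∀ᵐ y, c (rot R y) = c y) (hh : AEStronglyMeasurable h)
    (hi : Integrable fun x => c x * h x) :
    ∫ x, c x * radialAverage h x = ∫ x, c x * h x := by
  rw [← (integral_prod_of_rot_invariant (k := fun z => c z.1 * orbit h z)
    ((hc.comp_quasiMeasurePreserving Measure.quasiMeasurePreserving_fst).mul
      (aestronglyMeasurable_orbit hh)) hi fun R => ?_).2]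
  · simp only [radialAverage, integral_const_mul]
  · filter_upwards [hcr R] with y hy
    rw [hy, orbit_rot]

/-- Averaging does not change integrals against rotation equivariant vector fields. -/
theorem integral_inner_orbitGradient {A G : E N → E N} (hA : AEStronglyMeasurable A)
    (hAr : ∀ R : O N, ∀ᵐ y, A (rot R y) = rot R (A y)) (hG : LocallyIntegrable G)
    (hi : Integrable fun x => inner ℝ (A x) (G x)) :
    ∫ x, inner ℝ (A x) (∫ R, orbitGradient G (x, R) ∂(haarO N)) = ∫ x, inner ℝ (A x) (G x) := by
  have hmG := aestronglyMeasurable_orbitGradient hG.aestronglyMeasurable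
  rw [← (integral_prod_of_rot_invariant (k := fun z => inner ℝ (A z.1) (orbitGradient G z))
    ((hA.comp_quasiMeasurePreserving Measure.quasiMeasurePreserving_fst).inner hmG)
      hi fun R => ?_).2]
  · refine integral_congr_ae ?_
    filter_upwards [ae_integrable_fiber hmG hG fun R y => by
      rw [orbitGradient_rot, LinearIsometryEquiv.norm_map]] with x hx
    exact (integral_inner hx _).symm
  · filter_upwards [hAr R] with y hy
    rw [hy, orbitGradient_rot, LinearIsometryEquiv.inner_map_map]

end PLap

end

/-! ### Symmetric criticality and the conclusion. -/

noncomputable section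

namespace PLap

variable {N : ℕ} {p : ℝ} {V : ℝ → ℝ≥0∞}

theorem hasAdmissibleGrowth [Nontrivial (E N)] (hp : 1 < p) (hpN : p < N) {s : ℝ}
    (hs1 : 1 < s) (hs : N * p / (N * (p - 1) + p) < s) {K : ℝ → ℝ} (hK : CondK s K)
    {g : ℝ → ℝ → ℝ} (hg : IsCaratheodory g) (hg0 : CondG0 N p V g) {f : ℝ → ℝ}
    (hgf : CondG g K f) {q₁ q₂ : ℝ} (hq₁ : 1 < q₁) (hq₂ : 1 < q₂) {M : ℝ}
    (hf : ∀ t : ℝ, |f t| ≤ M * min (|t| ^ (q₁ - 1)) (|t| ^ (q₂ - 1)))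
    (hR : CondR N p V K q₁ q₂) :
    HasAdmissibleGrowth N p V g q₁ q₂ fun x => M * K ‖x‖ where
  caratheodory := hg
  bound := by
    filter_upwards [quasiMeasurePreserving_norm.ae hgf, ae_norm_pos] with x hx hpos t
    have h1 := mul_le_mul_of_nonneg_left (hf t) (hK.2.1 _ hpos).le
    calc |g ‖x‖ t - g ‖x‖ 0| ≤ K ‖x‖ * |f t| := hx t
      _ ≤ K ‖x‖ * (M * minPow q₁ q₂ t) := h1
      _ = _ := by ring
  integrable w h hw hh := by
    refine ((integrable_mul_minPow hp hpN hs1 hs hK hq₁ hq₂ hR hw hh).const_mul M).congr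
      (ae_of_all _ fun x => ?_)
    simp only [mul_assoc]
  integrable_zero := hg0.1

/-- Symmetric criticality: if the weak equation holds for radial test functions, then it holds for
all test functions. -/
theorem isWeakSolution_of_radial [Nontrivial (E N)] (hp : 1 < p) (hpN : p < N)
    (hV : AEMeasurable fun x : E N => V ‖x‖) {g : ℝ → ℝ → ℝ} {q₁ q₂ : ℝ} {k : E N → ℝ}
    (H : HasAdmissibleGrowth N p V g q₁ q₂ k) {u : E N → ℝ} (hu : MemWr p V u)
    (heq : ∀ η, MemWr p V η →
      (∫ x, ‖weakGradient u x‖ ^ (p - 2) * inner ℝ (weakGradient u x) (weakGradient η x)) +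
        ∫ x, (V ‖x‖).toReal * (|u x| ^ (p - 2) * u x * η x) = ∫ x, g ‖x‖ (u x) * η x) :
    IsWeakSolution p V g u := by
  refine ⟨hu, fun h hh => ⟨hu.1.integrable_grad_inner hp hh, hu.1.integrable_potential_mul hp hV hh,
    H.integrable_mul hu hh, ?_⟩⟩
  have hrad := fun R => ae_rot_eq_of_isRadial hu.2 R
  have hmu := hu.1.1.1.1
  have hmh := hh.1.1.1
  -- The field |∇u|^(p-2)∇u inherits equivariance from ∇u because rotations preserve norms.
  have e1 : ∫ x, ‖weakGradient u x‖ ^ (p - 2) *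
      inner ℝ (weakGradient u x) (weakGradient (radialAverage h) x) =
      ∫ x, ‖weakGradient u x‖ ^ (p - 2) * inner ℝ (weakGradient u x) (weakGradient h x) := by
    have h1 := integral_inner_orbitGradient
      (A := fun x => ‖weakGradient u x‖ ^ (p - 2) • weakGradient u x) (G := weakGradient h)
      ((hu.1.1.2.2.1.norm.aemeasurable.pow_const _).aestronglyMeasurable.smul hu.1.1.2.2.1)
      (fun R => by
        filter_upwards [ae_weakGradient_rot hu.2 hu.1.1.2.1 R] with y hy
        rw [hy, LinearIsometryEquiv.norm_map, map_smul])
      (hasWeakGradient_weakGradient hh.1.2.1).2.1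
      (by simpa only [inner_smul_left, conj_trivial] using hu.1.integrable_grad_inner hp hh)
    simp only [inner_smul_left, conj_trivial] at h1
    rw [← h1]
    refine integral_congr_ae ?_
    filter_upwards [(hh.hasWeakGradient_radialAverage hp hpN).weakGradient_ae_eq] with x hx
    rw [hx]
  have e2 : ∫ x, (V ‖x‖).toReal * (|u x| ^ (p - 2) * u x * radialAverage h x) =
      ∫ x, (V ‖x‖).toReal * (|u x| ^ (p - 2) * u x * h x) := by
    have h1 := integral_mul_radialAverage
      (c := fun x => (V ‖x‖).toReal * (|u x| ^ (p - 2) * u x)) (h := h)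
      (hV.ennreal_toReal.mul ((hmu.norm.aemeasurable.pow_const _).mul
        hmu.aemeasurable)).aestronglyMeasurable
      (fun R => by
        filter_upwards [hrad R] with y hy
        rw [hy, LinearIsometryEquiv.norm_map]) hmh
      (by simpa only [mul_assoc] using hu.1.integrable_potential_mul hp hV hh)
    simpa only [mul_assoc] using h1
  have e3 : ∫ x, g ‖x‖ (u x) * radialAverage h x = ∫ x, g ‖x‖ (u x) * h x :=
    integral_mul_radialAverage
      (H.caratheodory.aestronglyMeasurable_comp quasiMeasurePreserving_norm hmu.aemeasurable)
      (fun R => by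
        filter_upwards [hrad R] with y hy
        rw [hy, LinearIsometryEquiv.norm_map]) hmh (H.integrable_mul hu hh)
  rw [← e1, ← e2, ← e3]
  exact heq _ (hh.memWr_radialAverage hp hpN hV)

end PLap

end

theorem mainTheorem6 (N : ℕ) (p : ℝ) (hp : 1 < p) (hpN : p < N)
    (V : ℝ → ENNReal) (hV : PLap.CondV V)
    (s : ℝ) (hs1 : 1 < s) (hs : N * p / (N * (p - 1) + p) < s)
    (K : ℝ → ℝ) (hK : PLap.CondK s K)
    (g : ℝ → ℝ → ℝ) (hg : PLap.IsCaratheodory g) (hg0 : PLap.CondG0 N p V g)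
    (f : ℝ → ℝ) (hf : Continuous f) (hgf : PLap.CondG g K f)
    (q₁ q₂ : ℝ) (hq₁ : 1 < q₁) (hq₂ : 1 < q₂)
    (hfq : PLap.CondF f q₁ q₂) (hR : PLap.CondR N p V K q₁ q₂)
    (u : PLap.E N → ℝ) (hu : PLap.IsCriticalPoint p V g u) :
    PLap.IsWeakSolution p V g u := by
  have hN : 0 < N := by
    have : (0 : ℝ) < N := by linarith
    exact_mod_cast this
  have : Nonempty (Fin N) := ⟨⟨0, hN⟩⟩
  have : Nontrivial (PLap.E N) := inferInstance
  obtain ⟨M, -, hM⟩ := hfq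
  have hVm := PLap.aemeasurable_comp_norm (N := N) hV.1
  have H := PLap.hasAdmissibleGrowth hp hpN hs1 hs hK hg hg0 hgf hq₁ hq₂ hM hR
  exact PLap.isWeakSolution_of_radial hp hpN hVm H hu.1 fun η hη =>
    hu.weak_equation_of_radial hp hq₁ hq₂ hVm H hη
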